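/- All sets lie in the plane $\mathbb R^2$. A convex quadrangle $Q$ is the convex hull of four points in strictly convex position; it is called a trapezoid if it has a pair of parallel opposite sides (parallelograms included). $Q$ is of affine type $Q[x,y]$ if some affine transformation of the plane maps three consecutive vertices of $Q$, in their order, onto $(0,1)$, $(0,0)$, $(1,0)$ and the fourth vertex onto $(x,y)$. A $3$-self-affinity of $Q$ is a dissection $Q=\alpha_1(Q)\cup\alpha_2(Q)\cup\alpha_3(Q)$, where $\alpha_1,\alpha_2,\alpha_3$ are invertible affine transformations of the plane and the interiors of the $\alpha_i(Q)$ are mutually disjoint. It is based on a glass-cut dissection if the three pieces arise from $Q$ by two successive glass-cuts, where a glass-cut splits one of the pieces present so far along a line segment connecting two of its boundary points. Such a dissection is of combinatorial type $\mathcal A$ if both cuts join relatively inner points of the same two opposite sides of $Q$ and the two cuts are disjoint. It is of combinatorial type $\mathcal B$ if one cut joins relatively inner points of two opposite sides of $Q$ and the other cut joins a relatively inner point of the first cut with a relatively inner point of one of the two remaining sides of $Q$. **Theorem.** Let $Q$ be a convex quadrangle that is not a trapezoid. (i) $Q$ admits a $3$-self-affinity based on a glass-cut dissection of combinatorial type $\mathcal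 A$ if and only if $Q$ is of an affine type $Q[x,y]$ with $(x,y)$ from $$\mathbf A=\left\{(x,y): x+y>1,\ y<1,\ x<y,\ y^3+xy^2-x^2-y^2=0\right\}.$$ (ii) $Q$ admits a $3$-self-affinity based on a glass-cut dissection of combinatorial type $\mathcal B$ if and only if $Q$ is of an affine type $Q[x,y]$ with $(x,y)$ from one of the two families $$\mathbf B_1=\left\{(x,y): x+y>1,\ y<1,\ x<y,\ (x+1)y^2-(x+1)y+x(1-x)=0\right\}$$ or $$\mathbf B_2=\left\{(x,y): x+y>1,\ y<1,\ x<y,\ x^3+(-y^2+y-2)x^2+(-y^3+2y^2-y+1)x+y^2-y=0\right\}.$$ -/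

import Mathlib

/-- The plane. Only its affine structure and its topology are used, no metric. -/
abbrev Plane : Type := ℝ × ℝ

namespace QuadDissection

/-- The determinant of two plane vectors; it vanishes iff they are linearly dependent. -/
def cross (a b : Plane) : ℝ := a.1 * b.2 - a.2 * b.1

/-- `HasVertices Q v`: `Q` is the (non-degenerate) convex quadrangle with the consecutive vertices
`v 0, v 1, v 2, v 3`. The condition says that the boundary walk `v 0 → v 1 → v 2 → v 3 → v 0` always
turns strictly left, or always strictly right (indices modulo 4). Equivalently, the two other
vertices always lie strictly on one side of the line through `v i` and `v (i + 1)`. -/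
def HasVertices (Q : Set Plane) (v : Fin 4 → Plane) : Prop :=
  Q = convexHull ℝ (Set.range v) ∧
    ((∀ i, 0 < cross (v (i + 1) - v i) (v (i + 2) - v (i + 1))) ∨
      (∀ i, cross (v (i + 1) - v i) (v (i + 2) - v (i + 1)) < 0))

/-- Convex quadrangles, as closed convex subsets of the plane. -/
def IsConvexQuadrangle (Q : Set Plane) : Prop := ∃ v, HasVertices Q v

/-- Trapezoids (parallelograms included): some two opposite sides are parallel. As every cyclic
shift of a vertex sequence is again a vertex sequence, it suffices to mention one pair of sides. -/
def IsTrapezoid (Q : Set Plane) : Prop :=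
  ∃ v, HasVertices Q v ∧ cross (v 1 - v 0) (v 2 - v 3) = 0

/-- `Q` is of the affine type `Q[x,y]`: an affine transformation maps three consecutive vertices
of `Q` onto `(0,1)`, `(0,0)`, `(1,0)` and the fourth vertex onto `(x,y)`. -/
def IsOfAffineType (Q : Set Plane) (x y : ℝ) : Prop :=
  ∃ v, HasVertices Q v ∧ ∃ φ : Plane ≃ᵃ[ℝ] Plane,
    φ (v 0) = (0, 1) ∧ φ (v 1) = (0, 0) ∧ φ (v 2) = (1, 0) ∧ φ (v 3) = (x, y)

/-- The sets `D i` form a dissection of `Q`: they cover `Q` exactly, and their interiors are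
mutually disjoint. -/
def IsDissection {n : ℕ} (Q : Set Plane) (D : Fin n → Set Plane) : Prop :=
  Q = ⋃ i, D i ∧ Pairwise fun i j => Disjoint (interior (D i)) (interior (D j))

/-- `C₁`, `C₂` arise from the convex disc `C` by a glass-cut along the segment with the boundary
points `p`, `q` as endpoints. (A segment joining two boundary points of a convex disc splits it iff
its relative interior lies in the interior of the disc; the two pieces are then the parts of the
disc on the two closed sides of the line through `p` and `q`.) -/
def IsGlassCut (C C₁ C₂ : Set Plane) : Prop :=
  ∃ p ∈ frontier C, ∃ q ∈ frontier C, openSegment ℝ p q ⊆ interior C ∧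
    C₁ = {z ∈ C | 0 ≤ cross (q - p) (z - p)} ∧
    C₂ = {z ∈ C | cross (q - p) (z - p) ≤ 0}

/-- Families of pieces obtained from a convex disc `Q` by finitely many successive glass-cuts, each
one splitting one of the pieces present so far. -/
inductive IsGlassCutDissection (Q : Set Plane) : Multiset (Set Plane) → Prop
  | whole : IsGlassCutDissection Q {Q}
  | cut {C C₁ C₂ : Set Plane} {s : Multiset (Set Plane)} :
      IsGlassCutDissection Q (C ::ₘ s) → IsGlassCut C C₁ C₂ →
        IsGlassCutDissection Q (C₁ ::ₘ C₂ ::ₘ s)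

/-- Combinatorial type A: two disjoint cuts `p₁q₁` and `p₂q₂`, each joining relative inner points of
the two opposite sides `v 0 v 3` and `v 1 v 2` of `Q`. -/
def IsTypeA (Q : Set Plane) (D : Fin 3 → Set Plane) : Prop :=
  ∃ v, HasVertices Q v ∧ ∃ p₁ p₂ q₁ q₂ : Plane,
    p₂ ∈ openSegment ℝ (v 0) (v 3) ∧ p₁ ∈ openSegment ℝ (v 0) p₂ ∧
    q₂ ∈ openSegment ℝ (v 1) (v 2) ∧ q₁ ∈ openSegment ℝ (v 1) q₂ ∧
    ∃ σ : Equiv.Perm (Fin 3),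
      D (σ 0) = convexHull ℝ {v 0, v 1, q₁, p₁} ∧
      D (σ 1) = convexHull ℝ {p₁, q₁, q₂, p₂} ∧
      D (σ 2) = convexHull ℝ {p₂, q₂, v 2, v 3}

/-- Combinatorial type B: one cut `pq` joins relative inner points of the two opposite sides
`v 0 v 3` and `v 1 v 2` of `Q`, and a second cut `mn` joins a relative inner point of the first cut
with a relative inner point of the side `v 2 v 3` of `Q`. -/
def IsTypeB (Q : Set Plane) (D : Fin 3 → Set Plane) : Prop :=
  ∃ v, HasVertices Q v ∧ ∃ p q m n : Plane,
    p ∈ openSegment ℝ (v 0) (v 3) ∧ q ∈ openSegment ℝ (v 1) (v 2) ∧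
    m ∈ openSegment ℝ p q ∧ n ∈ openSegment ℝ (v 2) (v 3) ∧
    ∃ σ : Equiv.Perm (Fin 3),
      D (σ 0) = convexHull ℝ {v 0, v 1, q, p} ∧
      D (σ 1) = convexHull ℝ {m, q, v 2, n} ∧
      D (σ 2) = convexHull ℝ {p, m, n, v 3}

/-- `Q` admits a 3-self-affinity (a dissection into three images of itself under affine
transformations) based on a glass-cut dissection of the combinatorial type `T`. -/
def HasGlassCutSelfAffinity (T : Set Plane → (Fin 3 → Set Plane) → Prop) (Q : Set Plane) : Prop :=
  ∃ α : Fin 3 → Plane ≃ᵃ[ℝ] Plane,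
    IsDissection Q (fun i => α i '' Q) ∧
    IsGlassCutDissection Q (Finset.univ.val.map fun i => α i '' Q) ∧
    T Q (fun i => α i '' Q)

/-- The family of parameters for type A. -/
def familyA : Set (ℝ × ℝ) :=
  {(x, y) | x + y > 1 ∧ y < 1 ∧ x < y ∧ y ^ 3 + x * y ^ 2 - x ^ 2 - y ^ 2 = 0}

/-- The first family of parameters for type B. -/
def familyB₁ : Set (ℝ × ℝ) :=
  {(x, y) | x + y > 1 ∧ y < 1 ∧ x < y ∧ (x + 1) * y ^ 2 - (x + 1) * y + x * (1 - x) = 0}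

/-- The second family of parameters for type B. -/
def familyB₂ : Set (ℝ × ℝ) :=
  {(x, y) | x + y > 1 ∧ y < 1 ∧ x < y ∧
    x ^ 3 + (-y ^ 2 + y - 2) * x ^ 2 + (-y ^ 3 + 2 * y ^ 2 - y + 1) * x + y ^ 2 - y = 0}

end QuadDissection

/-!
Throughout, a quadrangle with labelled vertices is described by its four corner areas, the areas of
the triangles cut off by the diagonals. Up to a common factor they determine the labelled quadrangle
up to affine equivalence (`exists_affineEquiv`), and a set determines its vertices up to cyclic
shifts and reversal (`HasVertices.unique`), because vertices are extreme points.

The right invariant for cuts between two opposite sides consists of two ratios: on the line of each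
of these sides, the quotient of the distances of its two endpoints from the point where the lines
meet (`leftRatio`, `rightRatio`). If a cut joins the two sides, the ratios of the whole are the
products of the ratios of the two strips. For `Q[x,y]` with `x ≤ y < 1 < x + y`, and with
`z = x + y - 1`, the two choices of opposite sides give the ratio pairs `(z / y, x)` and
`(z / x, y)`, where `z / y < x ≤ y` and `z / x < y`. An affine copy of `Q` has one of these pairs,
in either order, or its reciprocals (`IsNormalLabelling.ratios_of_image`).

As `y` is the largest ratio that occurs, a dissection by a cut between two opposite sides has to use
the first pair for `Q`, and as all pieces have larger ratios than `Q`, a piece between the same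
sides has to use the second one. For type A this leaves `x = y² z / x` as the only possibility
(`mem_familyA_of_ratios`). For type B the piece cut off first has the second pair in the order
opposite to that of `Q`, and the remaining quadrangle has the ratios `z / y²` and `x² / z`. They
determine its ratios with respect to its other two sides (`ratios_shift_one`), and these must be
products of two pairs because of the second cut. The larger of these ratios comes from the same side
for the whole and for both of its parts and is `x²`, `x y` or `y²`, which gives the family `B₁`, the
family `B₂` and a contradiction (`mem_familyB_of_ratios`).

Conversely, any factorization of the ratios is realized by a cut (`exists_strip_ratios`), and a
strip whose ratios form one of the pairs is an affine copy of `Q`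
(`IsNormalLabelling.exists_image_eq`).
-/

namespace QuadDissection

/-! ### Corner areas -/

/-- Twice the signed area of the triangle `v i, v (i + 1), v (i + 2)` cut off from a quadrangle by
a diagonal. The ratios of the four numbers are a complete affine invariant of the labelled
quadrangle; for `Q[x,y]` they are `1 : y : x + y - 1 : x`. -/
def cornerArea (v : Fin 4 → Plane) (i : Fin 4) : ℝ :=
  cross (v (i + 1) - v i) (v (i + 2) - v (i + 1))

/-- The labels run around a strictly convex quadrangle, in either orientation. -/
def IsConvexLabelling (v : Fin 4 → Plane) : Prop :=
  (∀ i, 0 < cornerArea v i) ∨ (∀ i, cornerArea v i < 0)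

lemma hasVertices_iff {Q : Set Plane} {v : Fin 4 → Plane} :
    HasVertices Q v ↔ Q = convexHull ℝ (Set.range v) ∧ IsConvexLabelling v := Iff.rfl

lemma cornerArea_zero (v : Fin 4 → Plane) :
    cornerArea v 0 = cross (v 1 - v 0) (v 2 - v 1) := rfl

lemma cornerArea_one (v : Fin 4 → Plane) :
    cornerArea v 1 = cross (v 2 - v 1) (v 3 - v 2) := rfl

lemma cornerArea_two (v : Fin 4 → Plane) :
    cornerArea v 2 = cross (v 3 - v 2) (v 0 - v 3) := rfl

lemma cornerArea_three (v : Fin 4 → Plane) :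
    cornerArea v 3 = cross (v 0 - v 3) (v 1 - v 0) := rfl

lemma cornerArea_add (v : Fin 4 → Plane) :
    cornerArea v 0 + cornerArea v 2 = cornerArea v 1 + cornerArea v 3 := by
  simp only [cornerArea_zero, cornerArea_one, cornerArea_two, cornerArea_three, cross,
    Prod.fst_sub, Prod.snd_sub]
  ring

lemma cornerArea_shift (v : Fin 4 → Plane) (k i : Fin 4) :
    cornerArea (fun i => v (i + k)) i = cornerArea v (i + k) := by
  simp only [cornerArea, add_right_comm]

lemma cornerArea_reverse (v : Fin 4 → Plane) (k i : Fin 4) :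
    cornerArea (fun i => v (k - i)) i = - cornerArea v (k - i - 2) := by
  have h1 : k - (i + 2) + 1 = k - (i + 1) := by revert k i; decide
  have h2 : k - (i + 2) + 2 = k - i := by revert k i; decide
  have h3 : k - i - 2 = k - (i + 2) := by revert k i; decide
  simp only [cornerArea, h1, h2, h3, cross, Prod.fst_sub, Prod.snd_sub]
  ring

lemma HasVertices.shift {Q : Set Plane} {v : Fin 4 → Plane} (h : HasVertices Q v) (k : Fin 4) :
    HasVertices Q (fun i => v (i + k)) := by
  refine ⟨?_, ?_⟩
  · rw [h.1]
    congr 1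
    exact ((Equiv.addRight k).surjective.range_comp v).symm
  · rcases h.2 with h | h
    · left; intro i; have := cornerArea_shift v k i; unfold cornerArea at this; rw [this]; exact h _
    · right; intro i; have := cornerArea_shift v k i; unfold cornerArea at this; rw [this]; exact h _

lemma HasVertices.reverse {Q : Set Plane} {v : Fin 4 → Plane} (h : HasVertices Q v) (k : Fin 4) :
    HasVertices Q (fun i => v (k - i)) := by
  refine ⟨?_, ?_⟩
  · rw [h.1]
    congr 1
    exact ((Equiv.subLeft k).surjective.range_comp v).symm
  · rcases h.2 with h | h
    · right; intro i; have := cornerArea_reverse v k i; unfold cornerArea at this; rw [this]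
      exact neg_neg_of_pos (h _)
    · left; intro i; have := cornerArea_reverse v k i; unfold cornerArea at this; rw [this]
      exact neg_pos_of_neg (h _)

lemma IsConvexLabelling.ne_zero {v : Fin 4 → Plane} (h : IsConvexLabelling v) (i : Fin 4) :
    cornerArea v i ≠ 0 := by
  rcases h with h | h
  · exact (h i).ne'
  · exact (h i).ne

/-! ### Affine transformations and corner areas -/

/-- An affine transformation multiplies all signed areas by one nonzero factor, its determinant. -/
lemma exists_cross_map (φ : Plane ≃ᵃ[ℝ] Plane) :
    ∃ D : ℝ, D ≠ 0 ∧ ∀ a b c d : Plane,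
      cross (φ a - φ b) (φ c - φ d) = D * cross (a - b) (c - d) := by
  set L : Plane ≃ₗ[ℝ] Plane := φ.linear with hL
  have hlin : ∀ a b, φ a - φ b = L (a - b) := fun a b => by
    have := φ.toAffineMap.linearMap_vsub a b
    simpa using this.symm
  have hexp : ∀ u : Plane, L u = u.1 • L (1, 0) + u.2 • L (0, 1) := fun u => by
    rw [← map_smul, ← map_smul, ← map_add]
    congr 1
    ext <;> simp
  have hcross : ∀ u w : Plane, cross (L u) (L w) = cross (L (1, 0)) (L (0, 1)) * cross u w := by
    intro u w
    rw [hexp u, hexp w]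
    simp only [cross, Prod.fst_add, Prod.snd_add, Prod.smul_fst, Prod.smul_snd, smul_eq_mul]
    ring
  refine ⟨cross (L (1, 0)) (L (0, 1)), ?_, fun a b c d => by rw [hlin, hlin, hcross]⟩
  intro h0
  have := hcross (L.symm (1, 0)) (L.symm (0, 1))
  rw [h0, zero_mul, L.apply_symm_apply, L.apply_symm_apply] at this
  simp [cross] at this

lemma exists_cornerArea_map (φ : Plane ≃ᵃ[ℝ] Plane) :
    ∃ D : ℝ, D ≠ 0 ∧ ∀ (v : Fin 4 → Plane) (i : Fin 4),
      cornerArea (fun j => φ (v j)) i = D * cornerArea v i := by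
  obtain ⟨D, hD, h⟩ := exists_cross_map φ
  exact ⟨D, hD, fun v i => h _ _ _ _⟩

lemma HasVertices.map {Q : Set Plane} {v : Fin 4 → Plane} (h : HasVertices Q v)
    (φ : Plane ≃ᵃ[ℝ] Plane) : HasVertices (φ '' Q) (fun j => φ (v j)) := by
  obtain ⟨D, hD, hA⟩ := exists_cornerArea_map φ
  rw [hasVertices_iff] at h ⊢
  refine ⟨?_, ?_⟩
  · rw [h.1]
    have := φ.toAffineMap.image_convexHull (Set.range v)
    rw [← Set.range_comp] at this
    exact this
  · simp only [IsConvexLabelling, hA]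
    rcases hD.lt_or_gt with hD | hD <;> rcases h.2 with h | h
    · exact Or.inr fun i => mul_neg_of_neg_of_pos hD (h i)
    · exact Or.inl fun i => mul_pos_of_neg_of_neg hD (h i)
    · exact Or.inl fun i => mul_pos hD (h i)
    · exact Or.inr fun i => mul_neg_of_pos_of_neg hD (h i)

/-- The affine coordinates in which `v 0, v 1, v 2` become `(0,1), (0,0), (1,0)`; the fourth vertex
then gets the coordinates `A₃ / A₀` and `A₁ / A₀`, where the `Aᵢ` are the corner areas. -/
lemma exists_affineFrame (v : Fin 4 → Plane) (h : cornerArea v 0 ≠ 0) :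
    ∃ φ : Plane ≃ᵃ[ℝ] Plane, φ (v 0) = (0, 1) ∧ φ (v 1) = (0, 0) ∧ φ (v 2) = (1, 0) ∧
      φ (v 3) = (cornerArea v 3 / cornerArea v 0, cornerArea v 1 / cornerArea v 0) := by
  set D := cornerArea v 0 with hD
  have hD' : D = ((v 1).1 - (v 0).1) * ((v 2).2 - (v 1).2)
    - ((v 1).2 - (v 0).2) * ((v 2).1 - (v 1).1) := rfl
  let e : Plane ≃ₗ[ℝ] Plane :=
    { toFun := fun z => (cross (v 1 - v 0) z / D, cross (v 2 - v 1) z / D)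
      map_add' := fun a b => by
        ext <;> simp only [cross, Prod.fst_add, Prod.snd_add, Prod.fst_sub, Prod.snd_sub] <;> ring
      map_smul' := fun c a => by
        ext <;> simp only [cross, Prod.smul_fst, Prod.smul_snd, Prod.fst_sub, Prod.snd_sub,
          smul_eq_mul, RingHom.id_apply] <;> ring
      invFun := fun z => z.1 • (v 2 - v 1) + z.2 • (v 0 - v 1)
      left_inv := fun z => by
        ext <;> simp only [cross, Prod.smul_fst, Prod.smul_snd, Prod.fst_sub, Prod.snd_sub,
          Prod.fst_add, Prod.snd_add, smul_eq_mul] <;> field_simp <;> rw [hD'] <;> ring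
      right_inv := fun z => by
        ext <;> simp only [cross, Prod.smul_fst, Prod.smul_snd, Prod.fst_sub, Prod.snd_sub,
          Prod.fst_add, Prod.snd_add, smul_eq_mul] <;> field_simp <;> rw [hD'] <;> ring }
  let φ : Plane ≃ᵃ[ℝ] Plane := (AffineEquiv.constVAdd ℝ Plane (-(v 1))).trans e.toAffineEquiv
  have hφ : ∀ z, φ z = (cross (v 1 - v 0) (z - v 1) / D, cross (v 2 - v 1) (z - v 1) / D) := by
    intro z
    have : φ z = e (-(v 1) + z) := rfl
    rw [this, neg_add_eq_sub]
    rfl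
  refine ⟨φ, ?_, ?_, ?_, ?_⟩ <;> rw [hφ] <;> ext <;>
    simp only [cross, cornerArea_three, cornerArea_one, Prod.fst_sub, Prod.snd_sub] <;>
    field_simp <;> (try rw [hD']) <;> ring

/-- Labelled quadrangles with proportional corner areas are affinely equivalent. -/
lemma exists_affineEquiv {v w : Fin 4 → Plane} (hv : cornerArea v 0 ≠ 0)
    (hw : cornerArea w 0 ≠ 0) {c : ℝ} (h : ∀ i, cornerArea w i = c * cornerArea v i) :
    ∃ α : Plane ≃ᵃ[ℝ] Plane, ∀ i, α (v i) = w i := by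
  obtain ⟨φ, h0, h1, h2, h3⟩ := exists_affineFrame v hv
  obtain ⟨ψ, k0, k1, k2, k3⟩ := exists_affineFrame w hw
  have hc : c ≠ 0 := by
    rintro rfl
    exact hw (by rw [h, zero_mul])
  have e1 : cornerArea w 3 / cornerArea w 0 = cornerArea v 3 / cornerArea v 0 := by
    rw [h, h, mul_div_mul_left _ _ hc]
  have e2 : cornerArea w 1 / cornerArea w 0 = cornerArea v 1 / cornerArea v 0 := by
    rw [h, h, mul_div_mul_left _ _ hc]
  rw [e1, e2] at k3
  refine ⟨φ.trans ψ.symm, fun i => ?_⟩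
  rw [AffineEquiv.trans_apply, AffineEquiv.symm_apply_eq]
  fin_cases i
  · exact h0.trans k0.symm
  · exact h1.trans k1.symm
  · exact h2.trans k2.symm
  · exact h3.trans k3.symm

/-! ### Half-planes, vertices and glass-cuts -/

lemma cross_lineMap (d a b c : Plane) (u : ℝ) :
    cross d (AffineMap.lineMap a b u - c) = (1 - u) * cross d (a - c) + u * cross d (b - c) := by
  simp only [cross, AffineMap.lineMap_apply_module, Prod.fst_sub, Prod.snd_sub, Prod.fst_add,
    Prod.snd_add, Prod.smul_fst, Prod.smul_snd, smul_eq_mul]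
  ring

lemma convex_halfPlane (d c : Plane) : Convex ℝ {z : Plane | 0 ≤ cross d (z - c)} := by
  intro a ha b hb s t hs ht hst
  obtain rfl : s = 1 - t := by linarith
  have := cross_lineMap d a b c t
  rw [AffineMap.lineMap_apply_module] at this
  simp only [Set.mem_ofPred_eq] at *
  rw [this]
  positivity

lemma continuous_cross_sub (d c : Plane) : Continuous fun z : Plane => cross d (z - c) := by
  unfold cross
  fun_prop

/-- The affine function that vanishes on the side from `v i` to `v (i + 1)`. -/
def sideForm (v : Fin 4 → Plane) (i : Fin 4) (z : Plane) : ℝ := cross (v (i + 1) - v i) (z - v i)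

lemma mem_of_barycentric {S : Set Plane} (hS : Convex ℝ S) {a b c z : Plane} (ha : a ∈ S)
    (hb : b ∈ S) (hc : c ∈ S) {r s t : ℝ} (hr : 0 ≤ r) (hs : 0 ≤ s) (ht : 0 ≤ t)
    (h : r + s + t = 1) (hz : z = r • a + s • b + t • c) : z ∈ S := by
  have := hS.sum_mem (t := Finset.univ) (w := ![r, s, t]) (z := ![a, b, c])
    (by intro i _; fin_cases i <;> assumption) (by simpa [Fin.sum_univ_three] using h)
    (by intro i _; fin_cases i <;> assumption)
  rw [hz]
  simpa [Fin.sum_univ_three] using this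

/-- A positively oriented convex quadrangle is the intersection of four half-planes. -/
lemma convexHull_eq_sideForm {v : Fin 4 → Plane} (hv : ∀ i, 0 < cornerArea v i) :
    convexHull ℝ (Set.range v) = {z | ∀ i, 0 ≤ sideForm v i z} := by
  have h0 := hv 0
  have h1 := hv 1
  have h2 := hv 2
  have h3 := hv 3
  apply Set.Subset.antisymm
  · apply convexHull_min
    · rintro _ ⟨j, rfl⟩ i
      have e : ∀ i : Fin 4, sideForm v i (v i) = 0 ∧ sideForm v i (v (i + 1)) = 0 ∧
          sideForm v i (v (i + 2)) = cornerArea v i ∧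
          sideForm v i (v (i + 3)) = cornerArea v (i + 3) := by
        intro i
        have k1 : i + 3 + 1 = i := by revert i; decide
        have k2 : i + 3 + 2 = i + 1 := by revert i; decide
        simp only [sideForm, cornerArea, k1, k2, cross, Prod.fst_sub, Prod.snd_sub]
        refine ⟨?_, ?_, ?_, ?_⟩ <;> ring
      obtain ⟨e0, e1, e2, e3⟩ := e i
      have hj : j = i ∨ j = i + 1 ∨ j = i + 2 ∨ j = i + 3 := by
        clear e0 e1 e2 e3 e
        revert i j
        decide
      rcases hj with rfl | rfl | rfl | rfl
      · exact e0.ge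
      · exact e1.ge
      · rw [e2]; exact (hv _).le
      · rw [e3]; exact (hv _).le
    · have : {z | ∀ i, 0 ≤ sideForm v i z} = ⋂ i, {z | 0 ≤ cross (v (i + 1) - v i) (z - v i)} := by
        ext z; simp [sideForm]
      rw [this]
      exact convex_iInter fun i => convex_halfPlane _ _
  · intro z hz
    have z0 : 0 ≤ cross (v 1 - v 0) (z - v 0) := hz 0
    have z1 : 0 ≤ cross (v 2 - v 1) (z - v 1) := hz 1
    have z2 : 0 ≤ cross (v 3 - v 2) (z - v 2) := hz 2
    have z3 : 0 ≤ cross (v 0 - v 3) (z - v 3) := hz 3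
    have hm : ∀ i, v i ∈ convexHull ℝ (Set.range v) :=
      fun i => subset_convexHull ℝ _ (Set.mem_range_self i)
    -- the diagonal from `v 0` to `v 2` decides which of two triangles contains the point
    rcases le_total (cross (v 2 - v 0) (z - v 0)) 0 with hd | hd
    · refine mem_of_barycentric (convex_convexHull ℝ _) (hm 0) (hm 1) (hm 2)
        (r := cross (v 2 - v 1) (z - v 1) / cornerArea v 0)
        (s := - cross (v 2 - v 0) (z - v 0) / cornerArea v 0)
        (t := cross (v 1 - v 0) (z - v 0) / cornerArea v 0)
        (div_nonneg z1 h0.le) (div_nonneg (by linarith) h0.le) (div_nonneg z0 h0.le) ?_ ?_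
      · field_simp
        simp only [cornerArea_zero, cross, Prod.fst_sub, Prod.snd_sub]
        ring
      · ext <;> simp only [Prod.fst_add, Prod.snd_add, Prod.smul_fst, Prod.smul_snd, smul_eq_mul]
          <;> field_simp <;>
          simp only [cornerArea_zero, cross, Prod.fst_sub, Prod.snd_sub] <;> ring
    · refine mem_of_barycentric (convex_convexHull ℝ _) (hm 0) (hm 2) (hm 3)
        (r := cross (v 3 - v 2) (z - v 2) / cornerArea v 2)
        (s := cross (v 0 - v 3) (z - v 3) / cornerArea v 2)
        (t := cross (v 2 - v 0) (z - v 0) / cornerArea v 2)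
        (div_nonneg z2 h2.le) (div_nonneg z3 h2.le) (div_nonneg hd h2.le) ?_ ?_
      · field_simp
        simp only [cornerArea_two, cross, Prod.fst_sub, Prod.snd_sub]
        ring
      · ext <;> simp only [Prod.fst_add, Prod.snd_add, Prod.smul_fst, Prod.smul_snd, smul_eq_mul]
          <;> field_simp <;>
          simp only [cornerArea_two, cross, Prod.fst_sub, Prod.snd_sub] <;> ring

/-- The linear forms of the two sides that meet in a vertex are nonnegative on the quadrangle and
vanish together only in this vertex, which is therefore an extreme point. -/
lemma mem_extremePoints_of_pos {v : Fin 4 → Plane} (hv : ∀ i, 0 < cornerArea v i) (i : Fin 4) :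
    v i ∈ (convexHull ℝ (Set.range v)).extremePoints ℝ := by
  refine ⟨subset_convexHull ℝ _ (Set.mem_range_self i), ?_⟩
  intro a ha b hb hab
  rw [convexHull_eq_sideForm hv] at ha hb
  rw [openSegment_eq_image_lineMap] at hab
  obtain ⟨u, ⟨hu0, hu1⟩, hu⟩ := hab
  obtain ⟨j, rfl⟩ : ∃ j, i = j + 1 := ⟨i - 1, by simp⟩
  have key : ∀ k, sideForm v k (v (j + 1)) = 0 → sideForm v k a = 0 := by
    intro k hk
    have := cross_lineMap (v (k + 1) - v k) a b (v k) u
    rw [hu] at this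
    have e1 : (1 - u) * sideForm v k a + u * sideForm v k b = 0 := this.symm.trans hk
    have e2 : 0 ≤ u * sideForm v k b := mul_nonneg hu0.le (hb k)
    have e3 : 0 ≤ (1 - u) * sideForm v k a := mul_nonneg (by linarith) (ha k)
    have e4 : (1 - u) * sideForm v k a = 0 := by linarith
    rcases mul_eq_zero.1 e4 with h | h
    · linarith
    · exact h
  have ka := key j (by simp only [sideForm, cross]; ring)
  have kb := key (j + 1) (by simp [sideForm, cross])
  have hA := (hv j).ne'
  simp only [sideForm, cornerArea, cross, Prod.fst_sub, Prod.snd_sub,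
    show j + 1 + 1 = j + 2 by rw [add_assoc]; rfl] at ka kb hA
  ext
  · apply mul_left_cancel₀ hA
    linear_combination ((v (j + 2)).1 - (v (j + 1)).1) * ka - ((v (j + 1)).1 - (v j).1) * kb
  · apply mul_left_cancel₀ hA
    linear_combination ((v (j + 2)).2 - (v (j + 1)).2) * ka - ((v (j + 1)).2 - (v j).2) * kb

lemma HasVertices.mem_extremePoints {Q : Set Plane} {v : Fin 4 → Plane} (h : HasVertices Q v)
    (i : Fin 4) : v i ∈ Q.extremePoints ℝ := by
  rcases h.2 with hv | hv
  · rw [h.1]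
    exact mem_extremePoints_of_pos hv i
  · have hr := h.reverse 3
    have hpos : ∀ j, 0 < cornerArea (fun i => v (3 - i)) j := fun j => by
      rw [cornerArea_reverse]
      exact neg_pos_of_neg (hv _)
    have := mem_extremePoints_of_pos hpos (3 - i)
    rw [← hr.1] at this
    simpa using this

/-- The sign of a triangle spanned by three vertices depends only on their cyclic order. -/
lemma cross_pos_of_cyclic {v : Fin 4 → Plane} (hv : ∀ i, 0 < cornerArea v i) {a b c : Fin 4}
    (h : 0 < b - a ∧ b - a < c - a) : 0 < cross (v b - v a) (v c - v b) := by
  have h0 := hv 0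
  have h1 := hv 1
  have h2 := hv 2
  have h3 := hv 3
  simp only [cornerArea_zero, cornerArea_one, cornerArea_two, cornerArea_three, cross,
    Prod.fst_sub, Prod.snd_sub] at h0 h1 h2 h3 ⊢
  revert h
  fin_cases a <;> fin_cases b <;> fin_cases c <;> intro h <;>
    first
    | (exfalso; revert h; decide)
    | (clear h; simp only [Fin.reduceFinMk, Fin.mk_one, Fin.zero_eta]; linarith)

lemma dihedral_or_mixed (s : Fin 4 → Fin 4) (hs : Function.Injective s) :
    (∃ k, ∀ i, s i = i + k) ∨ (∃ k, ∀ i, s i = k - i) ∨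
    ((∃ i, 0 < s (i + 1) - s i ∧ s (i + 1) - s i < s (i + 2) - s i) ∧
      ∃ i, 0 < s (i + 1) - s (i + 2) ∧ s (i + 1) - s (i + 2) < s i - s (i + 2)) := by
  have key : ∀ a b c d : Fin 4, a ≠ b → a ≠ c → a ≠ d → b ≠ c → b ≠ d → c ≠ d →
      (∃ k, ∀ i, ![a, b, c, d] i = i + k) ∨ (∃ k, ∀ i, ![a, b, c, d] i = k - i) ∨
      ((∃ i, 0 < ![a, b, c, d] (i + 1) - ![a, b, c, d] i ∧
          ![a, b, c, d] (i + 1) - ![a, b, c, d] i < ![a, b, c, d] (i + 2) - ![a, b, c, d] i) ∧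
        ∃ i, 0 < ![a, b, c, d] (i + 1) - ![a, b, c, d] (i + 2) ∧
          ![a, b, c, d] (i + 1) - ![a, b, c, d] (i + 2) <
            ![a, b, c, d] i - ![a, b, c, d] (i + 2)) := by
    decide
  have e : s = ![s 0, s 1, s 2, s 3] := by
    ext i; fin_cases i <;> rfl
  rw [e]
  apply key <;> exact hs.ne (by decide)

/-- The vertices of a convex quadrangle are determined up to cyclic shifts and reversal. -/
lemma HasVertices.unique {Q : Set Plane} {v w : Fin 4 → Plane} (hv : HasVertices Q v)
    (hw : HasVertices Q w) : ∃ k, (∀ i, w i = v (i + k)) ∨ (∀ i, w i = v (k - i)) := by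
  wlog hpos : ∀ i, 0 < cornerArea v i generalizing v
  · have hneg : ∀ i, cornerArea v i < 0 := hv.2.resolve_left hpos
    obtain ⟨k, h | h⟩ := this (hv.reverse 3) fun j => by
      rw [cornerArea_reverse]; exact neg_pos_of_neg (hneg _)
    · exact ⟨3 - k, Or.inr fun i => by rw [h, sub_sub, add_comm]⟩
    · exact ⟨3 - k, Or.inl fun i => by rw [h]; congr 1; abel⟩
  have hmem : ∀ i, ∃ j, v j = w i := fun i => by
    have h1 := hw.mem_extremePoints i
    rw [hv.1] at h1
    exact (extremePoints_convexHull_subset h1 : w i ∈ Set.range v)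
  choose s hs using hmem
  have hinj : Function.Injective w := by
    intro i j hij
    by_contra hne
    have hj : j = i + 1 ∨ i = j + 1 ∨ j = i + 2 := by clear hij; revert i j; decide
    have hA := fun i => IsConvexLabelling.ne_zero (show IsConvexLabelling w from hw.2) i
    rcases hj with rfl | rfl | rfl
    · exact hA i (by simp [cornerArea, cross, ← hij])
    · exact hA j (by simp [cornerArea, cross, hij])
    · exact hA i (by simp only [cornerArea, cross, ← hij, Prod.fst_sub, Prod.snd_sub]; ring)
  have hsinj : Function.Injective s := fun i j hij => hinj (by rw [← hs, ← hs, hij])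
  rcases dihedral_or_mixed s hsinj with ⟨k, hk⟩ | ⟨k, hk⟩ | ⟨⟨i, hi⟩, ⟨j, hj⟩⟩
  · exact ⟨k, Or.inl fun i => by rw [← hs, hk]⟩
  · exact ⟨k, Or.inr fun i => by rw [← hs, hk]⟩
  · exfalso
    have e1 := cross_pos_of_cyclic hpos hi
    have e2 := cross_pos_of_cyclic hpos hj
    simp only [hs] at e1 e2
    rcases hw.2 with h | h
    · have := h j
      simp only [cross, Prod.fst_sub, Prod.snd_sub] at this e2
      linarith
    · exact absurd (h i) (not_lt.2 e1.le)

lemma pos_of_mem_interior {S : Set Plane} {d c z : Plane} (hd : d ≠ 0)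
    (hS : ∀ z ∈ S, 0 ≤ cross d (z - c)) (hz : z ∈ interior S) : 0 < cross d (z - c) := by
  rw [mem_interior_iff_mem_nhds] at hz
  have hcont : Continuous fun ε : ℝ => z + ε • ((d.2, -d.1) : Plane) := by fun_prop
  have hmem : ∀ᶠ ε in nhdsWithin (0 : ℝ) (Set.Ioi 0), z + ε • ((d.2, -d.1) : Plane) ∈ S := by
    apply (hcont.continuousAt (x := 0)).eventually_mem _ |>.filter_mono nhdsWithin_le_nhds
    simpa using hz
  obtain ⟨ε, h1, h2⟩ := (hmem.and self_mem_nhdsWithin).exists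
  have h3 := hS _ h1
  have h4 : cross d (z + ε • ((d.2, -d.1) : Plane) - c)
      = cross d (z - c) - ε * (d.1 ^ 2 + d.2 ^ 2) := by
    simp only [cross, Prod.fst_sub, Prod.snd_sub, Prod.fst_add, Prod.snd_add, Prod.smul_fst,
      Prod.smul_snd, smul_eq_mul]
    ring
  have h5 : 0 < d.1 ^ 2 + d.2 ^ 2 := by
    by_contra h
    apply hd
    ext
    · simp only [Prod.fst_zero]; nlinarith [sq_nonneg d.1, sq_nonneg d.2]
    · simp only [Prod.snd_zero]; nlinarith [sq_nonneg d.1, sq_nonneg d.2]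
  have h6 : 0 < ε * (d.1 ^ 2 + d.2 ^ 2) := mul_pos h2 h5
  linarith

lemma IsGlassCut.symm {C C₁ C₂ : Set Plane} (h : IsGlassCut C C₁ C₂) : IsGlassCut C C₂ C₁ := by
  obtain ⟨p, hp, q, hq, hpq, h1, h2⟩ := h
  have e : ∀ z, cross (p - q) (z - q) = - cross (q - p) (z - p) := fun z => by
    simp only [cross, Prod.fst_sub, Prod.snd_sub]; ring
  refine ⟨q, hq, p, hp, by rwa [openSegment_symm], ?_, ?_⟩
  · rw [h2]; ext z; simp [e]
  · rw [h1]; ext z; simp [e]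

lemma IsGlassCut.union_eq {C C₁ C₂ : Set Plane} (h : IsGlassCut C C₁ C₂) : C₁ ∪ C₂ = C := by
  obtain ⟨p, hp, q, hq, hpq, rfl, rfl⟩ := h
  ext z
  simp only [Set.mem_union, Set.mem_ofPred_eq, ← and_or_left, and_iff_left_iff_imp]
  exact fun _ => le_total _ _

lemma IsGlassCut.disjoint_interior {C C₁ C₂ : Set Plane} (h : IsGlassCut C C₁ C₂) :
    Disjoint (interior C₁) (interior C₂) := by
  have hs := h.symm
  obtain ⟨p, hp, q, hq, hpq, rfl, rfl⟩ := h
  have hne : q ≠ p := by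
    rintro rfl
    rw [openSegment_same, Set.singleton_subset_iff] at hpq
    exact hp.2 hpq
  rw [Set.disjoint_left]
  intro z h1 h2
  have k1 := pos_of_mem_interior (sub_ne_zero.2 hne) (fun z hz => hz.2) h1
  have k2 := pos_of_mem_interior (d := p - q) (c := p) (sub_ne_zero.2 hne.symm)
    (fun z hz => by
      have := hz.2
      simp only [cross, Prod.fst_sub, Prod.snd_sub] at this ⊢
      linarith) h2
  simp only [cross, Prod.fst_sub, Prod.snd_sub] at k1 k2
  linarith

/-- Two successive glass-cuts, the second one splitting a piece of the first, give a dissection. -/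
lemma isDissection_of_two_cuts {Q C₁ C₂ C₃ R : Set Plane} (h : IsGlassCut Q C₁ R)
    (h' : IsGlassCut R C₂ C₃) : IsDissection Q ![C₁, C₂, C₃] := by
  have h2 : C₂ ⊆ R := h'.union_eq ▸ Set.subset_union_left
  have h3 : C₃ ⊆ R := h'.union_eq ▸ Set.subset_union_right
  have d := h.disjoint_interior
  have d2 := d.mono_right (interior_mono h2)
  have d3 := d.mono_right (interior_mono h3)
  have d23 := h'.disjoint_interior
  refine ⟨?_, ?_⟩
  · rw [← h.union_eq, ← h'.union_eq]
    ext z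
    simp [Fin.exists_fin_succ]
  · intro i j hij
    fin_cases i <;> fin_cases j <;>
      first
      | exact absurd rfl hij
      | exact d2
      | exact d3
      | exact d23
      | exact d2.symm
      | exact d3.symm
      | exact d23.symm

lemma isGlassCutDissection_of_two_cuts {Q C₁ C₂ C₃ R : Set Plane} (h : IsGlassCut Q C₁ R)
    (h' : IsGlassCut R C₂ C₃) :
    IsGlassCutDissection Q (Finset.univ.val.map ![C₁, C₂, C₃]) := by
  have hc := IsGlassCutDissection.cut (IsGlassCutDissection.cut .whole h.symm) h'
  convert hc using 1
  have : (Finset.univ : Finset (Fin 3)).val = 0 ::ₘ 1 ::ₘ {2} := rfl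
  rw [this]
  simp only [Multiset.map_cons, Multiset.map_singleton]
  change C₁ ::ₘ C₂ ::ₘ C₃ ::ₘ 0 = _
  rw [Multiset.cons_swap C₁, Multiset.cons_swap C₁]

/-! ### Strips between two opposite sides -/

/-- The quadrangle cut out between the points with the parameters `s`, `s'` on the side from `v 0`
to `v 3` and the points with the parameters `t`, `t'` on the side from `v 1` to `v 2`. -/
def strip (v : Fin 4 → Plane) (s t s' t' : ℝ) : Fin 4 → Plane :=
  ![AffineMap.lineMap (v 0) (v 3) s, AffineMap.lineMap (v 1) (v 2) t,
    AffineMap.lineMap (v 1) (v 2) t', AffineMap.lineMap (v 0) (v 3) s']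

lemma strip_reverse (v : Fin 4 → Plane) (s t s' t' : ℝ) :
    strip (fun i => v (3 - i)) s t s' t' =
      fun i => strip v (1 - s') (1 - t') (1 - s) (1 - t) (3 - i) := by
  funext i
  fin_cases i <;> simp [strip, AffineMap.lineMap_apply_one_sub]

lemma cornerArea_strip (v : Fin 4 → Plane) (s t s' t' : ℝ) :
    cornerArea (strip v s t s' t') 0 = (t' - t) * ((1 - s) * cornerArea v 0 + s * cornerArea v 1) ∧
    cornerArea (strip v s t s' t') 1 =
      (t' - t) * ((1 - s') * cornerArea v 0 + s' * cornerArea v 1) ∧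
    cornerArea (strip v s t s' t') 2 =
      (s' - s) * ((1 - t') * cornerArea v 3 + t' * cornerArea v 2) ∧
    cornerArea (strip v s t s' t') 3 =
      (s' - s) * ((1 - t) * cornerArea v 3 + t * cornerArea v 2) := by
  have e0 : strip v s t s' t' 0 = AffineMap.lineMap (v 0) (v 3) s := rfl
  have e1 : strip v s t s' t' 1 = AffineMap.lineMap (v 1) (v 2) t := rfl
  have e2 : strip v s t s' t' 2 = AffineMap.lineMap (v 1) (v 2) t' := rfl
  have e3 : strip v s t s' t' 3 = AffineMap.lineMap (v 0) (v 3) s' := rfl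
  simp only [cornerArea_zero, cornerArea_one, cornerArea_two, cornerArea_three, e0, e1, e2, e3,
    AffineMap.lineMap_apply_module, cross, Prod.fst_sub, Prod.snd_sub, Prod.fst_add,
    Prod.snd_add, Prod.smul_fst, Prod.smul_snd, smul_eq_mul]
  refine ⟨?_, ?_, ?_, ?_⟩ <;> ring

lemma convexCombination_pos {a b s : ℝ} (ha : 0 < a) (hb : 0 < b) (h0 : 0 ≤ s) (h1 : s ≤ 1) :
    0 < (1 - s) * a + s * b := by
  rcases h0.eq_or_lt with rfl | h0
  · simpa using ha
  · have := mul_pos h0 hb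
    have := mul_nonneg (sub_nonneg.2 h1) ha.le
    linarith

lemma cornerArea_strip_pos {v : Fin 4 → Plane} (hv : ∀ i, 0 < cornerArea v i) {s t s' t' : ℝ}
    (hs : 0 ≤ s) (hss : s < s') (hs' : s' ≤ 1) (ht : 0 ≤ t) (htt : t < t') (ht' : t' ≤ 1) :
    ∀ i, 0 < cornerArea (strip v s t s' t') i := by
  obtain ⟨e0, e1, e2, e3⟩ := cornerArea_strip v s t s' t'
  intro i
  have hs1 := sub_pos.2 hss
  have ht1 := sub_pos.2 htt
  fin_cases i
  · exact e0 ▸ mul_pos ht1 (convexCombination_pos (hv 0) (hv 1) hs (by linarith))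
  · exact e1 ▸ mul_pos ht1 (convexCombination_pos (hv 0) (hv 1) (by linarith) hs')
  · exact e2 ▸ mul_pos hs1 (convexCombination_pos (hv 3) (hv 2) (by linarith) ht')
  · exact e3 ▸ mul_pos hs1 (convexCombination_pos (hv 3) (hv 2) ht (by linarith))

lemma IsConvexLabelling.strip {v : Fin 4 → Plane} (hv : IsConvexLabelling v) {s t s' t' : ℝ}
    (hs : 0 ≤ s) (hss : s < s') (hs' : s' ≤ 1) (ht : 0 ≤ t) (htt : t < t') (ht' : t' ≤ 1) :
    IsConvexLabelling (strip v s t s' t') := by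
  rcases hv with hv | hv
  · exact Or.inl (cornerArea_strip_pos hv hs hss hs' ht htt ht')
  · right
    have hpos : ∀ j, 0 < cornerArea (fun i => v (3 - i)) j := fun j => by
      rw [cornerArea_reverse]
      exact neg_pos_of_neg (hv _)
    intro i
    have := cornerArea_strip_pos hpos (s := 1 - s') (s' := 1 - s) (t := 1 - t') (t' := 1 - t)
      (by linarith) (by linarith) (by linarith) (by linarith) (by linarith) (by linarith)
      (3 - i - 2)
    rw [strip_reverse, cornerArea_reverse] at this
    simp only [sub_sub_cancel] at this
    have e : ∀ i : Fin 4, 3 - (3 - i - 2) - 2 = i := by decide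
    rw [e] at this
    linarith

lemma range_reverse (w : Fin 4 → Plane) : Set.range (fun i => w (3 - i)) = Set.range w :=
  (Equiv.subLeft (3 : Fin 4)).surjective.range_comp w

lemma range_shift (w : Fin 4 → Plane) (k : Fin 4) :
    Set.range (fun i => w (i + k)) = Set.range w :=
  (Equiv.addRight k).surjective.range_comp w

lemma isGlassCut_strip_of_pos {v : Fin 4 → Plane} (hv : ∀ i, 0 < cornerArea v i) {s t : ℝ}
    (hs0 : 0 < s) (hs1 : s < 1) (ht0 : 0 < t) (ht1 : t < 1) :
    IsGlassCut (convexHull ℝ (Set.range v)) (convexHull ℝ (Set.range (strip v 0 0 s t)))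
      (convexHull ℝ (Set.range (strip v s t 1 1))) := by
  set p : Plane := AffineMap.lineMap (v 0) (v 3) s with hp
  set q : Plane := AffineMap.lineMap (v 1) (v 2) t with hq
  have hvm : ∀ i, v i ∈ convexHull ℝ (Set.range v) :=
    fun i => subset_convexHull ℝ _ (Set.mem_range_self i)
  have hpQ : p ∈ convexHull ℝ (Set.range v) :=
    (convex_convexHull ℝ _).lineMap_mem (hvm 0) (hvm 3) ⟨hs0.le, hs1.le⟩
  have hqQ : q ∈ convexHull ℝ (Set.range v) :=
    (convex_convexHull ℝ _).lineMap_mem (hvm 1) (hvm 2) ⟨ht0.le, ht1.le⟩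
  have E := convexHull_eq_sideForm hv
  have e1 := convexHull_eq_sideForm (cornerArea_strip_pos hv le_rfl hs0 hs1.le le_rfl ht0 ht1.le)
  have e2 := convexHull_eq_sideForm (cornerArea_strip_pos hv hs0.le hs1 le_rfl ht0.le ht1 le_rfl)
  have m1 : convexHull ℝ (Set.range (strip v 0 0 s t)) ⊆ convexHull ℝ (Set.range v) := by
    apply convexHull_min _ (convex_convexHull ℝ _)
    rintro _ ⟨i, rfl⟩
    fin_cases i
    · simpa [strip] using hvm 0
    · simpa [strip] using hvm 1
    · exact hqQ
    · exact hpQ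
  have m2 : convexHull ℝ (Set.range (strip v s t 1 1)) ⊆ convexHull ℝ (Set.range v) := by
    apply convexHull_min _ (convex_convexHull ℝ _)
    rintro _ ⟨i, rfl⟩
    fin_cases i
    · exact hpQ
    · exact hqQ
    · simpa [strip] using hvm 2
    · simpa [strip] using hvm 3
  have f0 : ∀ z, sideForm v 0 z = cross (v 1 - v 0) (z - v 0) := fun _ => rfl
  have f1 : ∀ z, sideForm v 1 z = cross (v 2 - v 1) (z - v 1) := fun _ => rfl
  have f2 : ∀ z, sideForm v 2 z = cross (v 3 - v 2) (z - v 2) := fun _ => rfl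
  have f3 : ∀ z, sideForm v 3 z = cross (v 0 - v 3) (z - v 3) := fun _ => rfl
  have vp : sideForm v 0 p = s * cornerArea v 3 ∧ sideForm v 2 p = (1 - s) * cornerArea v 2 ∧
      sideForm v 1 p = (1 - s) * cornerArea v 0 + s * cornerArea v 1 ∧ sideForm v 3 p = 0 := by
    simp only [f0, f1, f2, f3, hp, cornerArea_zero, cornerArea_one, cornerArea_two,
      cornerArea_three, cross_lineMap]
    simp only [cross, Prod.fst_sub, Prod.snd_sub]
    refine ⟨?_, ?_, ?_, ?_⟩ <;> ring
  have vq : sideForm v 0 q = t * cornerArea v 0 ∧ sideForm v 2 q = (1 - t) * cornerArea v 1 ∧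
      sideForm v 3 q = (1 - t) * cornerArea v 3 + t * cornerArea v 2 ∧ sideForm v 1 q = 0 := by
    simp only [f0, f1, f2, f3, hq, cornerArea_zero, cornerArea_one, cornerArea_two,
      cornerArea_three, cross_lineMap]
    simp only [cross, Prod.fst_sub, Prod.snd_sub]
    refine ⟨?_, ?_, ?_, ?_⟩ <;> ring
  have hside : ∀ (k : Fin 4), v (k + 1) - v k ≠ 0 := fun k h => by
    have := hv k
    simp [cornerArea, h, cross] at this
  have notint : ∀ (k : Fin 4) z, sideForm v k z = 0 →
      z ∉ interior (convexHull ℝ (Set.range v)) := fun k z hz hz' => by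
    have := pos_of_mem_interior (hside k) (fun w hw => by rw [E] at hw; exact hw k) hz'
    exact this.ne' hz
  refine ⟨q, ⟨subset_closure hqQ, notint 1 q vq.2.2.2⟩, p,
    ⟨subset_closure hpQ, notint 3 p vp.2.2.2⟩, ?_, ?_, ?_⟩
  · have hopen : IsOpen {z | ∀ i, 0 < sideForm v i z} := by
      have : {z | ∀ i, 0 < sideForm v i z} = ⋂ i, {z | 0 < sideForm v i z} := by ext; simp
      rw [this]
      exact isOpen_iInter_of_finite fun i =>
        isOpen_lt continuous_const (continuous_cross_sub _ _)
    have hsub : {z | ∀ i, 0 < sideForm v i z} ⊆ convexHull ℝ (Set.range v) := by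
      rw [E]; exact fun z hz i => (hz i).le
    refine Set.Subset.trans ?_ (interior_maximal hsub hopen)
    rw [openSegment_eq_image_lineMap]
    rintro _ ⟨u, ⟨hu0, hu1⟩, rfl⟩ i
    have hu : sideForm v i (AffineMap.lineMap q p u)
      = (1 - u) * sideForm v i q + u * sideForm v i p := cross_lineMap _ _ _ _ _
    rw [hu]
    have hu1' : 0 < 1 - u := by linarith
    have hs1' : 0 < 1 - s := by linarith
    have ht1' : 0 < 1 - t := by linarith
    have a0 := hv 0
    have a1 := hv 1
    have a2 := hv 2
    have a3 := hv 3
    obtain ⟨p0, p2, p1, p3⟩ := vp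
    obtain ⟨q0, q2, q3, q1⟩ := vq
    fin_cases i <;> simp only [Fin.reduceFinMk, Fin.mk_one, Fin.zero_eta]
    · rw [p0, q0]; positivity
    · rw [p1, q1]; positivity
    · rw [p2, q2]; positivity
    · rw [p3, q3]; positivity
  · ext z
    have g1 : sideForm (strip v 0 0 s t) 1 z = t * sideForm v 1 z := by
      simp only [sideForm, strip, cross, AffineMap.lineMap_apply_module]
      simp
      ring
    have g3 : sideForm (strip v 0 0 s t) 3 z = s * sideForm v 3 z := by
      simp only [sideForm, strip, cross, AffineMap.lineMap_apply_module]
      simp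
      ring
    have g0 : sideForm (strip v 0 0 s t) 0 z = sideForm v 0 z := by
      simp [sideForm, strip]
    constructor
    · intro hz
      refine ⟨m1 hz, ?_⟩
      rw [e1] at hz
      exact hz 2
    · rintro ⟨hz, hz'⟩
      rw [E] at hz
      rw [e1]
      intro i
      fin_cases i
      · exact (hz 0).trans_eq g0.symm
      · exact (mul_nonneg ht0.le (hz 1)).trans_eq g1.symm
      · exact hz'
      · exact (mul_nonneg hs0.le (hz 3)).trans_eq g3.symm
  · ext z
    have g0 : sideForm (strip v s t 1 1) 0 z = - cross (p - q) (z - q) := by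
      have : sideForm (strip v s t 1 1) 0 z = cross (q - p) (z - p) := rfl
      rw [this]
      simp only [cross, Prod.fst_sub, Prod.snd_sub]
      ring
    have g1 : sideForm (strip v s t 1 1) 1 z = (1 - t) * sideForm v 1 z := by
      simp only [sideForm, strip, cross, AffineMap.lineMap_apply_module]
      simp
      ring
    have g3 : sideForm (strip v s t 1 1) 3 z = (1 - s) * sideForm v 3 z := by
      simp only [sideForm, strip, cross, AffineMap.lineMap_apply_module]
      simp
      ring
    have g2 : sideForm (strip v s t 1 1) 2 z = sideForm v 2 z := by
      simp [sideForm, strip]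
    constructor
    · intro hz
      refine ⟨m2 hz, ?_⟩
      rw [e2] at hz
      have := hz 0
      rw [g0] at this
      exact neg_nonneg.1 this
    · rintro ⟨hz, hz'⟩
      rw [E] at hz
      rw [e2]
      intro i
      fin_cases i
      · exact (neg_nonneg.2 hz').trans_eq g0.symm
      · exact (mul_nonneg (sub_nonneg.2 ht1.le) (hz 1)).trans_eq g1.symm
      · exact (hz 2).trans_eq g2.symm
      · exact (mul_nonneg (sub_nonneg.2 hs1.le) (hz 3)).trans_eq g3.symm

/-- A segment joining relatively inner points of two opposite sides is a glass-cut into strips. -/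
lemma isGlassCut_strip {v : Fin 4 → Plane} (hv : IsConvexLabelling v) {s t : ℝ}
    (hs0 : 0 < s) (hs1 : s < 1) (ht0 : 0 < t) (ht1 : t < 1) :
    IsGlassCut (convexHull ℝ (Set.range v)) (convexHull ℝ (Set.range (strip v 0 0 s t)))
      (convexHull ℝ (Set.range (strip v s t 1 1))) := by
  rcases hv with hv | hv
  · exact isGlassCut_strip_of_pos hv hs0 hs1 ht0 ht1
  · have hpos : ∀ j, 0 < cornerArea (fun i => v (3 - i)) j := fun j => by
      rw [cornerArea_reverse]
      exact neg_pos_of_neg (hv _)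
    have := (isGlassCut_strip_of_pos hpos (s := 1 - s) (t := 1 - t) (by linarith) (by linarith)
      (by linarith) (by linarith)).symm
    rw [strip_reverse, strip_reverse, range_reverse, range_reverse, range_reverse] at this
    simpa using this

/-! ### Ratio pairs -/

/-- The parameters are in normal position: every convex quadrangle that is not a trapezoid has an
affine type `Q[x,y]` with these bounds. -/
structure IsNormalized (x y : ℝ) : Prop where
  le : x ≤ y
  lt_one : y < 1
  one_lt : 1 < x + y

/-- The lines of two opposite sides of `Q[x,y]` meet in a point; on each of the two lines, compare
the distance from that point to the nearer vertex with the distance to the farther one. The two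
quotients, in either order, are `ρ` and `σ`. Each of the two choices of opposite sides contributes
two ordered pairs. -/
def IsRatioPair (x y ρ σ : ℝ) : Prop :=
  (ρ = (x + y - 1) / y ∧ σ = x) ∨ (ρ = x ∧ σ = (x + y - 1) / y) ∨
    (ρ = (x + y - 1) / x ∧ σ = y) ∨ (ρ = y ∧ σ = (x + y - 1) / x)

lemma IsRatioPair.swap {x y ρ σ : ℝ} (h : IsRatioPair x y ρ σ) : IsRatioPair x y σ ρ := by
  unfold IsRatioPair at *
  tauto

namespace IsNormalized

variable {x y : ℝ}

lemma x_pos (h : IsNormalized x y) : 0 < x := by linarith [h.lt_one, h.one_lt]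

lemma y_pos (h : IsNormalized x y) : 0 < y := h.x_pos.trans_le h.le

lemma z_pos (h : IsNormalized x y) : 0 < x + y - 1 := by linarith [h.one_lt]

lemma x_lt_one (h : IsNormalized x y) : x < 1 := h.le.trans_lt h.lt_one

lemma z_lt_mul (h : IsNormalized x y) : x + y - 1 < x * y := by
  nlinarith [mul_pos (sub_pos.2 h.x_lt_one) (sub_pos.2 h.lt_one)]

lemma z_div_y_lt (h : IsNormalized x y) : (x + y - 1) / y < x := by
  rw [div_lt_iff₀ h.y_pos]; exact h.z_lt_mul

lemma z_div_x_lt (h : IsNormalized x y) : (x + y - 1) / x < y := by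
  rw [div_lt_iff₀ h.x_pos, mul_comm]; exact h.z_lt_mul

end IsNormalized

namespace IsRatioPair

variable {x y ρ σ : ℝ}

lemma left_pos (h : IsRatioPair x y ρ σ) (hn : IsNormalized x y) : 0 < ρ := by
  have := hn.x_pos
  have := hn.y_pos
  have := hn.z_pos
  rcases h with ⟨rfl, -⟩ | ⟨rfl, -⟩ | ⟨rfl, -⟩ | ⟨rfl, -⟩ <;> positivity

lemma left_le (h : IsRatioPair x y ρ σ) (hn : IsNormalized x y) : ρ ≤ y := by
  have := hn.z_div_y_lt
  have := hn.z_div_x_lt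
  have := hn.le
  rcases h with ⟨rfl, -⟩ | ⟨rfl, -⟩ | ⟨rfl, -⟩ | ⟨rfl, -⟩ <;> linarith

lemma left_lt_one (h : IsRatioPair x y ρ σ) (hn : IsNormalized x y) : ρ < 1 :=
  (h.left_le hn).trans_lt hn.lt_one

/-- Only the pair `((x + y - 1) / x, y)`, in either order, can have an entry that exceeds `x`. -/
lemma of_lt_right (h : IsRatioPair x y ρ σ) (hn : IsNormalized x y) (hx : x < σ) :
    (ρ = (x + y - 1) / x ∧ σ = y) ∨ (ρ = y ∧ σ = (x + y - 1) / x) := by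
  have := hn.z_div_y_lt
  rcases h with ⟨-, h⟩ | ⟨-, h⟩ | h | h
  · linarith
  · linarith
  · exact Or.inl h
  · exact Or.inr h

/-- As `y` is the largest entry of all ratio pairs, a pair whose entries are proper multiples of
entries of ratio pairs has the entries `(x + y - 1) / y` and `x`. -/
lemma of_lt (h : IsRatioPair x y ρ σ) (h1 : ρ < y) (h2 : σ < y) :
    (ρ = (x + y - 1) / y ∧ σ = x) ∨ (ρ = x ∧ σ = (x + y - 1) / y) := by
  rcases h with h | h | ⟨-, h⟩ | ⟨h, -⟩
  · exact Or.inl h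
  · exact Or.inr h
  · linarith
  · linarith

end IsRatioPair

/-- All three pieces have the ratio pair `(R, y)` with `R = (x + y - 1) / x`, up to its order. Two
of them in one order and one in the other gives the curve; the remaining distributions contradict
`(x + y - 1) / y < x` or `R < y`. -/
lemma mem_familyA_of_ratios_aux {x y a₁ b₁ a₂ b₂ a₃ b₃ : ℝ} (hn : IsNormalized x y)
    (h₁ : IsRatioPair x y a₁ b₁) (h₂ : IsRatioPair x y a₂ b₂) (h₃ : IsRatioPair x y a₃ b₃)
    (ha : (x + y - 1) / y = a₁ * a₂ * a₃) (hb : x = b₁ * b₂ * b₃) : (x, y) ∈ familyA := by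
  have p1 := h₁.swap.left_pos hn
  have p2 := h₂.swap.left_pos hn
  have p3 := h₃.swap.left_pos hn
  have l1 := h₁.swap.left_lt_one hn
  have l2 := h₂.swap.left_lt_one hn
  have l3 := h₃.swap.left_lt_one hn
  have lx1 : x < b₁ := by
    have : b₂ * b₃ < 1 := by nlinarith
    nlinarith
  have lx2 : x < b₂ := by
    have : b₁ * b₃ < 1 := by nlinarith
    nlinarith
  have lx3 : x < b₃ := by
    have : b₁ * b₂ < 1 := by nlinarith
    nlinarith
  have hxy : x < y := lx1.trans_le (h₁.swap.left_le hn)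
  have hx := hn.x_pos
  have hy := hn.y_pos
  have hz := hn.z_pos
  have hy1 := hn.lt_one
  have hab : (x + y - 1) / y < x := hn.z_div_y_lt
  have hR : (x + y - 1) / x < y := hn.z_div_x_lt
  have hRp : 0 < (x + y - 1) / x := by positivity
  have hRx : (x + y - 1) / x * x = x + y - 1 := by field_simp
  have hry : (x + y - 1) / y * y = x + y - 1 := by field_simp
  set R := (x + y - 1) / x with hRdef
  have one : x = y * y * R → (x, y) ∈ familyA := fun h => by
    refine ⟨by linarith [hn.one_lt], hy1, hxy, ?_⟩
    have : x * x = y * y * (x + y - 1) := by rw [← hRx, ← mul_assoc, ← h]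
    linear_combination -this
  rw [ha] at hab hry
  have bad : a₁ * a₂ * a₃ = y * y * R → b₁ * b₂ * b₃ = y * R * R → False := fun e1 e2 => by
    have : y * R * R < y * R * y := mul_lt_mul_of_pos_left hR (by positivity)
    rw [hb, e1, e2] at hab
    linarith
  rcases h₁.of_lt_right hn lx1 with ⟨ha1, hb1⟩ | ⟨ha1, hb1⟩ <;>
  rcases h₂.of_lt_right hn lx2 with ⟨ha2, hb2⟩ | ⟨ha2, hb2⟩ <;>
  rcases h₃.of_lt_right hn lx3 with ⟨ha3, hb3⟩ | ⟨ha3, hb3⟩ <;>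
  rw [← hRdef] at *
  · -- here `x = y ^ 3`, and then the equation for the other ratio forces `R = y`
    exfalso
    rw [ha1, ha2, ha3] at hry
    have hxy3 : x = y ^ 3 := by rw [hb, hb1, hb2, hb3]; ring
    have h1 : R * (R * R * y) = R * x := by linear_combination hry - hRx
    have h2 : R * R * y = x := mul_left_cancel₀ hRp.ne' h1
    have h3 : R = y := by
      have : R * R = y * y := by
        apply mul_right_cancel₀ hy.ne'
        rw [h2, hxy3]; ring
      nlinarith
    linarith
  · exact one (by rw [hb, hb1, hb2, hb3])
  · exact one (by rw [hb, hb1, hb2, hb3]; ring)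
  · exact (bad (by rw [ha1, ha2, ha3]; ring) (by rw [hb1, hb2, hb3])).elim
  · exact one (by rw [hb, hb1, hb2, hb3]; ring)
  · exact (bad (by rw [ha1, ha2, ha3]; ring) (by rw [hb1, hb2, hb3]; ring)).elim
  · exact (bad (by rw [ha1, ha2, ha3]) (by rw [hb1, hb2, hb3]; ring)).elim
  · exfalso
    have : R * R * R < y * y * y := by
      have := mul_lt_mul hR hR.le hRp hy.le
      exact mul_lt_mul this hR.le hRp (by positivity)
    rw [hb, ha1, ha2, ha3, hb1, hb2, hb3] at hab
    linarith

/-- If the ratios of the whole are the products of those of the three pieces, then the parameters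
lie on the curve of type A. -/
lemma mem_familyA_of_ratios {x y a b a₁ b₁ a₂ b₂ a₃ b₃ : ℝ} (hn : IsNormalized x y)
    (h : IsRatioPair x y a b) (h₁ : IsRatioPair x y a₁ b₁) (h₂ : IsRatioPair x y a₂ b₂)
    (h₃ : IsRatioPair x y a₃ b₃) (ha : a = a₁ * a₂ * a₃) (hb : b = b₁ * b₂ * b₃) :
    (x, y) ∈ familyA := by
  have lt : ∀ {a a₁ b₁ a₂ b₂ a₃ b₃ : ℝ}, IsRatioPair x y a₁ b₁ → IsRatioPair x y a₂ b₂ →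
      IsRatioPair x y a₃ b₃ → a = a₁ * a₂ * a₃ → a < y := by
    intro a a₁ b₁ a₂ b₂ a₃ b₃ h₁ h₂ h₃ ha
    have p1 := h₁.left_pos hn
    have p2 := h₂.left_pos hn
    have p3 := h₃.left_pos hn
    have l1 := h₁.left_le hn
    have l2 := h₂.left_lt_one hn
    have l3 := h₃.left_lt_one hn
    have : a₂ * a₃ < 1 := by nlinarith
    rw [ha]
    nlinarith
  rcases h.of_lt (lt h₁ h₂ h₃ ha) (lt h₁.swap h₂.swap h₃.swap hb) with
    ⟨rfl, rfl⟩ | ⟨rfl, rfl⟩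
  · exact mem_familyA_of_ratios_aux hn h₁ h₂ h₃ ha hb
  · exact mem_familyA_of_ratios_aux hn h₁.swap h₂.swap h₃.swap hb ha

/-- `g` and `g'` are the entrywise products of two ratio pairs, or their reciprocals are. -/
def IsPairProduct (x y g g' : ℝ) : Prop :=
  ∃ ρ₁ σ₁ ρ₂ σ₂, IsRatioPair x y ρ₁ σ₁ ∧ IsRatioPair x y ρ₂ σ₂ ∧
    ((g = ρ₁ * ρ₂ ∧ g' = σ₁ * σ₂) ∨ (g⁻¹ = ρ₁ * ρ₂ ∧ g'⁻¹ = σ₁ * σ₂))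

lemma IsPairProduct.swap {x y g g' : ℝ} (h : IsPairProduct x y g g') :
    IsPairProduct x y g' g := by
  obtain ⟨ρ₁, σ₁, ρ₂, σ₂, h₁, h₂, h⟩ := h
  exact ⟨σ₁, ρ₁, σ₂, ρ₂, h₁.swap, h₂.swap, h.imp And.symm And.symm⟩

/-- The piece cut off first must have the ratio pair `(y, (x + y - 1) / x)`, which determines `c`
and `d`. The larger ratio at the other apex is then one of `x ^ 2`, `x * y`, `y ^ 2`; the first two give
the two families, the last one is impossible. -/
lemma mem_familyB_of_ratios_aux {x y a₁ b₁ c d : ℝ} (hn : IsNormalized x y)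
    (h₁ : IsRatioPair x y a₁ b₁) (ha : (x + y - 1) / y = a₁ * c) (hb : x = b₁ * d)
    (hc : c < 1) (hd : d < 1)
    (hg : IsPairProduct x y ((1 - d) / (1 - c)) ((1 - d) / (1 - c) * (c / d))) :
    (x, y) ∈ familyB₁ ∪ familyB₂ := by
  have hx := hn.x_pos
  have hy := hn.y_pos
  have hz := hn.z_pos
  have hy1 := hn.lt_one
  have hx1 := hn.x_lt_one
  have lx : x < b₁ := by
    have := h₁.swap.left_pos hn
    nlinarith
  have hxy : x < y := lx.trans_le (h₁.swap.left_le hn)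
  have hr : (x + y - 1) / y < x := hn.z_div_y_lt
  have hrp : 0 < (x + y - 1) / y := by positivity
  have hR : (x + y - 1) / x < y := hn.z_div_x_lt
  have hRp : 0 < (x + y - 1) / x := by positivity
  have hRx : (x + y - 1) / x * x = x + y - 1 := by field_simp
  have hry : (x + y - 1) / y * y = x + y - 1 := by field_simp
  obtain ⟨u₁, v₁, u₂, v₂, k₁, k₂, hk⟩ := hg
  have pu1 := k₁.left_pos hn
  have pu2 := k₂.left_pos hn
  have lu1 := k₁.left_lt_one hn
  have lu2 := k₂.left_lt_one hn
  have lu : u₁ * u₂ < 1 := by nlinarith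
  rcases h₁.of_lt_right hn lx with ⟨ha1, hb1⟩ | ⟨ha1, hb1⟩
  · -- here the remaining piece would be a trapezoid
    exfalso
    have hcd : c = d := by
      have e1 : (x + y - 1) * (y * c) = (x + y - 1) * x := by
        rw [ha1] at ha
        linear_combination x * hry - x * y * ha - c * y * hRx
      have e2 : y * c = y * d := by
        rw [mul_left_cancel₀ hz.ne' e1, hb1.symm, ← hb]
      exact mul_left_cancel₀ hy.ne' e2
    subst hcd
    rw [div_self (by linarith), inv_one] at hk
    rcases hk with ⟨h, -⟩ | ⟨h, -⟩ <;> linarith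
  have ec : c * y ^ 2 = x + y - 1 := by
    rw [ha1] at ha
    linear_combination hry - y * ha
  have ed : (x + y - 1) * d = x ^ 2 := by
    rw [hb1] at hb
    linear_combination -d * hRx - x * hb
  have hcp : 0 < c := by
    by_contra h
    nlinarith [sq_nonneg y]
  have hdp : 0 < d := by
    by_contra h
    nlinarith [sq_nonneg x]
  have hcd : c < d := by
    have : y * c < y * d := by
      have h1 : y * c = (x + y - 1) / y := by rw [ha, ha1]
      have h2 : (x + y - 1) / x * d = x := by rw [← hb1, ← hb]
      have h3 : (x + y - 1) / x * d < y * d := mul_lt_mul_of_pos_right hR hdp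
      linarith
    exact lt_of_mul_lt_mul_left this hy.le
  have hc1 : 0 < 1 - c := by linarith
  have hT1 : (1 - d) / (1 - c) < 1 := by rw [div_lt_one hc1]; linarith
  have hT0 : 0 < (1 - d) / (1 - c) := div_pos (by linarith) hc1
  have hTc : (1 - d) / (1 - c) * (1 - c) = 1 - d := by field_simp
  have hlt : (1 - d) / (1 - c) * (c / d) < (1 - d) / (1 - c) := by
    have : c / d < 1 := (div_lt_one hdp).2 hcd
    nlinarith
  set T := (1 - d) / (1 - c)
  -- the equation for the first of the two ratios at the second apex
  have main : T * ((x + y - 1) * (y ^ 2 - (x + y - 1))) = y ^ 2 * (x + y - 1 - x ^ 2) := by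
    linear_combination (x + y - 1) * y ^ 2 * hTc + T * (x + y - 1) * ec - y ^ 2 * ed
  rcases hk with ⟨hu, hv⟩ | ⟨hu, -⟩
  swap
  · exfalso
    have : 1 < T⁻¹ := (one_lt_inv₀ hT0).2 hT1
    linarith
  rw [hv, hu] at hlt
  rw [hu] at main
  have tB1 : u₁ * u₂ = x * x → (x, y) ∈ familyB₁ ∪ familyB₂ := fun h => by
    left
    refine ⟨by linarith [hn.one_lt], hy1, hxy, ?_⟩
    rw [h] at main
    have hne : (1 - x) * (x + y) ≠ 0 := (mul_pos (by linarith) (by linarith)).ne'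
    apply mul_left_cancel₀ hne
    linear_combination -main
  have tB2 : u₁ * u₂ = x * y → (x, y) ∈ familyB₁ ∪ familyB₂ := fun h => by
    right
    refine ⟨by linarith [hn.one_lt], hy1, hxy, ?_⟩
    rw [h] at main
    apply mul_left_cancel₀ hy.ne'
    linear_combination -main
  have tB3 : u₁ * u₂ = y * y → False := fun h => by
    rw [h] at main
    have : y ^ 2 * ((x + y) * (1 - y) ^ 2) = 0 := by linear_combination main
    have : 0 < y ^ 2 * ((x + y) * (1 - y) ^ 2) := by
      have : 0 < 1 - y := by linarith
      positivity
    linarith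
  have small : ∀ {r s r' s' : ℝ}, 0 < r → 0 < r' → r < s → r' < s' → u₁ = r → v₁ = s → u₂ = r' →
      v₂ = s' → False := by
    rintro r s r' s' h0 h0' h1 h2 rfl rfl rfl rfl
    have := mul_lt_mul h1 h2.le h0' (h0.trans h1).le
    linarith
  rcases k₁ with ⟨e1, f1⟩ | ⟨e1, f1⟩ | ⟨e1, f1⟩ | ⟨e1, f1⟩ <;>
  rcases k₂ with ⟨e2, f2⟩ | ⟨e2, f2⟩ | ⟨e2, f2⟩ | ⟨e2, f2⟩
  all_goals first
    | (apply tB1; rw [e1, e2]; done)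
    | (apply tB2; rw [e1, e2]; done)
    | (apply tB2; rw [e1, e2, mul_comm]; done)
    | (exfalso; apply tB3; rw [e1, e2]; done)
    | exact (small hrp hrp hr hr e1 f1 e2 f2).elim
    | exact (small hrp hRp hr hR e1 f1 e2 f2).elim
    | exact (small hRp hrp hR hr e1 f1 e2 f2).elim
    | exact (small hRp hRp hR hR e1 f1 e2 f2).elim
    | (exfalso; rw [e1, e2, f1, f2] at hlt; linarith)

/-- `(a, b)` are the ratios of the whole, `(a₁, b₁)` those of the piece cut off by the first cut and
`(c, d)` those of the remaining quadrangle, whose ratios with respect to its other two sides are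
products because of the second cut. -/
lemma mem_familyB_of_ratios {x y a b a₁ b₁ c d : ℝ} (hn : IsNormalized x y)
    (h : IsRatioPair x y a b) (h₁ : IsRatioPair x y a₁ b₁) (ha : a = a₁ * c) (hb : b = b₁ * d)
    (hc : c < 1) (hd : d < 1)
    (hg : IsPairProduct x y ((1 - d) / (1 - c)) ((1 - d) / (1 - c) * (c / d))) :
    (x, y) ∈ familyB₁ ∪ familyB₂ := by
  have p1 := h₁.left_pos hn
  have p2 := h₁.swap.left_pos hn
  have l1 := h₁.left_le hn
  have l2 := h₁.swap.left_le hn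
  have hcp : 0 < c := pos_of_mul_pos_right (ha ▸ h.left_pos hn) p1.le
  have hdp : 0 < d := pos_of_mul_pos_right (hb ▸ h.swap.left_pos hn) p2.le
  rcases h.of_lt (by rw [ha]; nlinarith) (by rw [hb]; nlinarith) with ⟨rfl, rfl⟩ | ⟨rfl, rfl⟩
  · exact mem_familyB_of_ratios_aux hn h₁ ha hb hc hd hg
  · refine mem_familyB_of_ratios_aux hn h₁.swap hb ha hd hc ?_
    obtain ⟨u₁, v₁, u₂, v₂, k₁, k₂, hk⟩ := hg
    refine ⟨u₁, v₁, u₂, v₂, k₁, k₂, hk.symm.imp ?_ ?_⟩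
    · rintro ⟨e1, e2⟩
      refine ⟨by rw [← e1, inv_div], ?_⟩
      rw [← e2, mul_inv, inv_div, inv_div]
    · rintro ⟨e1, e2⟩
      refine ⟨by rw [← e1, inv_div], ?_⟩
      rw [← e2, mul_inv, inv_div, inv_div]

/-! ### Ratios of labelled quadrangles -/

/-- The ratio of the distances of `v 0` and `v 3` from the line through `v 1` and `v 2`. -/
noncomputable def leftRatio (v : Fin 4 → Plane) : ℝ := cornerArea v 0 / cornerArea v 1

/-- The ratio of the distances of `v 1` and `v 2` from the line through `v 0` and `v 3`. -/
noncomputable def rightRatio (v : Fin 4 → Plane) : ℝ := cornerArea v 3 / cornerArea v 2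

lemma IsConvexLabelling.leftRatio_pos {v : Fin 4 → Plane} (h : IsConvexLabelling v) :
    0 < leftRatio v := by
  rcases h with h | h
  · exact div_pos (h 0) (h 1)
  · exact div_pos_of_neg_of_neg (h 0) (h 1)

lemma IsConvexLabelling.rightRatio_pos {v : Fin 4 → Plane} (h : IsConvexLabelling v) :
    0 < rightRatio v := by
  rcases h with h | h
  · exact div_pos (h 3) (h 2)
  · exact div_pos_of_neg_of_neg (h 3) (h 2)

lemma IsConvexLabelling.exists_one_sub_rightRatio {v : Fin 4 → Plane} (h : IsConvexLabelling v) :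
    ∃ k, 0 < k ∧ 1 - rightRatio v = k * (1 - leftRatio v) := by
  have h1 := h.ne_zero 1
  have h2 := h.ne_zero 2
  have hs := cornerArea_add v
  refine ⟨cornerArea v 1 / cornerArea v 2, ?_, ?_⟩
  · rcases h with h | h
    · exact div_pos (h 1) (h 2)
    · exact div_pos_of_neg_of_neg (h 1) (h 2)
  · unfold leftRatio rightRatio
    field_simp
    linarith

lemma IsConvexLabelling.rightRatio_lt_one {v : Fin 4 → Plane} (h : IsConvexLabelling v)
    (hl : leftRatio v < 1) : rightRatio v < 1 := by
  obtain ⟨k, hk, e⟩ := h.exists_one_sub_rightRatio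
  have := mul_pos hk (sub_pos.2 hl)
  linarith

lemma IsConvexLabelling.one_lt_rightRatio {v : Fin 4 → Plane} (h : IsConvexLabelling v)
    (hl : 1 < leftRatio v) : 1 < rightRatio v := by
  obtain ⟨k, hk, e⟩ := h.exists_one_sub_rightRatio
  have := mul_pos hk (sub_pos.2 hl)
  nlinarith

lemma IsConvexLabelling.shift {v : Fin 4 → Plane} (h : IsConvexLabelling v) (k : Fin 4) :
    IsConvexLabelling fun i => v (i + k) :=
  (HasVertices.shift (Q := convexHull ℝ (Set.range v)) ⟨rfl, h⟩ k).2

/-- The ratios with respect to one pair of opposite sides determine those with respect to the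
other pair. -/
lemma ratios_shift_one {v : Fin 4 → Plane} (h : IsConvexLabelling v) (hl : leftRatio v ≠ 1) :
    leftRatio (fun i => v (i + 1)) = (1 - rightRatio v) / (1 - leftRatio v) ∧
      rightRatio (fun i => v (i + 1)) =
        (1 - rightRatio v) / (1 - leftRatio v) * (leftRatio v / rightRatio v) := by
  have h0 := h.ne_zero 0
  have h1 := h.ne_zero 1
  have h2 := h.ne_zero 2
  have h3 := h.ne_zero 3
  have hs := cornerArea_add v
  have hne : cornerArea v 1 - cornerArea v 0 ≠ 0 := fun h => hl (by
    unfold leftRatio; rw [div_eq_one_iff_eq h1]; linarith)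
  have key : (1 - rightRatio v) / (1 - leftRatio v) = cornerArea v 1 / cornerArea v 2 := by
    have e1 : 1 - leftRatio v = (cornerArea v 1 - cornerArea v 0) / cornerArea v 1 := by
      unfold leftRatio; field_simp
    have e2 : 1 - rightRatio v = (cornerArea v 1 - cornerArea v 0) / cornerArea v 2 := by
      unfold rightRatio; field_simp; linarith
    rw [e1, e2]
    field_simp
  have l : leftRatio (fun i => v (i + 1)) = cornerArea v 1 / cornerArea v 2 := by
    unfold leftRatio
    rw [cornerArea_shift, cornerArea_shift]
    rfl
  have r : rightRatio (fun i => v (i + 1)) = cornerArea v 0 / cornerArea v 3 := by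
    unfold rightRatio
    rw [cornerArea_shift, cornerArea_shift]
    rfl
  rw [key, l, r]
  refine ⟨rfl, ?_⟩
  unfold leftRatio rightRatio
  field_simp

lemma leftRatio_strip {v : Fin 4 → Plane} (h : IsConvexLabelling v) {s t s' t' : ℝ}
    (ht : t < t') : leftRatio (strip v s t s' t') =
      ((1 - s) * leftRatio v + s) / ((1 - s') * leftRatio v + s') := by
  obtain ⟨e0, e1, -, -⟩ := cornerArea_strip v s t s' t'
  have h1 := h.ne_zero 1
  have ht' := (sub_pos.2 ht).ne'
  have e : ∀ u : ℝ, (1 - u) * leftRatio v + u =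
      ((1 - u) * cornerArea v 0 + u * cornerArea v 1) / cornerArea v 1 := fun u => by
    unfold leftRatio; field_simp
  rw [e, e, div_div_div_cancel_right₀ h1, leftRatio, e0, e1, mul_div_mul_left _ _ ht']

lemma rightRatio_strip {v : Fin 4 → Plane} (h : IsConvexLabelling v) {s t s' t' : ℝ}
    (hs : s < s') : rightRatio (strip v s t s' t') =
      ((1 - t) * rightRatio v + t) / ((1 - t') * rightRatio v + t') := by
  obtain ⟨-, -, e2, e3⟩ := cornerArea_strip v s t s' t'
  have h2 := h.ne_zero 2
  have hs' := (sub_pos.2 hs).ne'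
  have e : ∀ u : ℝ, (1 - u) * rightRatio v + u =
      ((1 - u) * cornerArea v 3 + u * cornerArea v 2) / cornerArea v 2 := fun u => by
    unfold rightRatio; field_simp
  rw [e, e, div_div_div_cancel_right₀ h2, rightRatio, e2, e3, mul_div_mul_left _ _ hs']

/-! ### Affine copies in normal position -/

/-- `v` labels the vertices of `Q` so that the affine type is `Q[x,y]`, and `(x, y)` is in normal
position. The type is recorded through the corner areas. -/
structure IsNormalLabelling (Q : Set Plane) (v : Fin 4 → Plane) (x y : ℝ) : Prop where
  hasVertices : HasVertices Q v
  normalized : IsNormalized x y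
  area_three : cornerArea v 3 = x * cornerArea v 0
  area_one : cornerArea v 1 = y * cornerArea v 0

namespace IsNormalLabelling

variable {Q : Set Plane} {v : Fin 4 → Plane} {x y : ℝ}

lemma convexLabelling (h : IsNormalLabelling Q v x y) : IsConvexLabelling v := h.hasVertices.2

lemma cornerArea_eq (h : IsNormalLabelling Q v x y) (i : Fin 4) :
    cornerArea v i = cornerArea v 0 * ![1, y, x + y - 1, x] i := by
  have h1 := h.area_one
  have h3 := h.area_three
  have h2 := cornerArea_add v
  fin_cases i
  · simp
  · simp [h1, mul_comm]
  · simp only [Fin.reduceFinMk, Matrix.cons_val]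
    linarith
  · simp [h3, mul_comm]

lemma isOfAffineType (h : IsNormalLabelling Q v x y) : IsOfAffineType Q x y := by
  have h0 := h.convexLabelling.ne_zero 0
  obtain ⟨φ, e0, e1, e2, e3⟩ := exists_affineFrame v h0
  rw [h.area_one, h.area_three, mul_div_cancel_right₀ _ h0, mul_div_cancel_right₀ _ h0] at e3
  exact ⟨v, h.hasVertices, φ, e0, e1, e2, e3⟩

/-- The eight labellings of an affine copy of `Q` realize the ratio pairs and their reciprocals. -/
lemma ratios_of_image (h : IsNormalLabelling Q v x y) {α : Plane ≃ᵃ[ℝ] Plane}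
    {w : Fin 4 → Plane} (hw : HasVertices (α '' Q) w) :
    IsRatioPair x y (leftRatio w) (rightRatio w) ∨
      IsRatioPair x y (leftRatio w)⁻¹ (rightRatio w)⁻¹ := by
  obtain ⟨D, hD, hA⟩ := exists_cornerArea_map α
  have hn := h.normalized
  obtain ⟨c, hc, k, hk⟩ : ∃ c : ℝ, c ≠ 0 ∧ ∃ k : Fin 4,
      (∀ i, cornerArea w i = c * ![1, y, x + y - 1, x] (i + k)) ∨
      (∀ i, cornerArea w i = c * ![1, y, x + y - 1, x] (k - i - 2)) := by
    have h0 := mul_ne_zero hD (h.convexLabelling.ne_zero 0)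
    obtain ⟨k, hk | hk⟩ := (h.hasVertices.map α).unique hw
    · refine ⟨_, h0, k, Or.inl fun i => ?_⟩
      rw [funext hk]
      rw [cornerArea_shift (fun j => α (v j)), hA, h.cornerArea_eq, mul_assoc]
    · refine ⟨_, neg_ne_zero.2 h0, k, Or.inr fun i => ?_⟩
      rw [funext hk]
      rw [cornerArea_reverse (fun j => α (v j)), hA, h.cornerArea_eq, neg_mul, mul_assoc]
  have key : ∀ a b a' b' : ℝ, cornerArea w 0 = c * a → cornerArea w 1 = c * b →
      cornerArea w 3 = c * a' → cornerArea w 2 = c * b' →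
      leftRatio w = a / b ∧ rightRatio w = a' / b' := by
    intro a b a' b' h1 h2 h3 h4
    rw [leftRatio, rightRatio, h1, h2, h3, h4, mul_div_mul_left _ _ hc, mul_div_mul_left _ _ hc]
    exact ⟨rfl, rfl⟩
  unfold IsRatioPair
  rcases hk with hk | hk
  · obtain ⟨e1, e2⟩ := key _ _ _ _ (hk 0) (hk 1) (hk 3) (hk 2)
    rw [e1, e2]
    fin_cases k <;> simp
  · obtain ⟨e1, e2⟩ := key _ _ _ _ (hk 0) (hk 1) (hk 3) (hk 2)
    rw [e1, e2]
    have n1 : (-1 - 2 : Fin 4) = 1 := rfl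
    have n2 : (-2 - 2 : Fin 4) = 0 := rfl
    have n3 : (-3 - 2 : Fin 4) = 3 := rfl
    fin_cases k <;> simp [n1, n2, n3]

lemma ratios_of_image_of_lt_one (h : IsNormalLabelling Q v x y) {α : Plane ≃ᵃ[ℝ] Plane}
    {w : Fin 4 → Plane} (hw : HasVertices (α '' Q) w) (hl : leftRatio w < 1) :
    IsRatioPair x y (leftRatio w) (rightRatio w) := by
  refine (h.ratios_of_image hw).resolve_right fun h' => ?_
  have h1 := h'.left_lt_one h.normalized
  have h2 := (one_lt_inv₀ (IsConvexLabelling.leftRatio_pos (hasVertices_iff.1 hw).2)).2 hl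
  linarith

lemma ratios_of_image_of_one_lt (h : IsNormalLabelling Q v x y) {α : Plane ≃ᵃ[ℝ] Plane}
    {w : Fin 4 → Plane} (hw : HasVertices (α '' Q) w) (hl : 1 < leftRatio w) :
    IsRatioPair x y (leftRatio w)⁻¹ (rightRatio w)⁻¹ := by
  refine (h.ratios_of_image hw).resolve_left fun h' => ?_
  have h1 := h'.left_lt_one h.normalized
  linarith

lemma leftRatio_ne_one (h : IsNormalLabelling Q v x y) {α : Plane ≃ᵃ[ℝ] Plane}
    {w : Fin 4 → Plane} (hw : HasVertices (α '' Q) w) : leftRatio w ≠ 1 := by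
  intro hl
  rcases h.ratios_of_image hw with h' | h'
  · have := h'.left_lt_one h.normalized
    linarith
  · have := h'.left_lt_one h.normalized
    rw [hl, inv_one] at this
    linarith

end IsNormalLabelling

/-- Normal position is reached by making the largest corner area the one at the vertex that is sent
to the origin, and by reversing the labels if necessary. -/
lemma exists_isNormalLabelling {Q : Set Plane} (hQ : IsConvexQuadrangle Q)
    (hT : ¬ IsTrapezoid Q) : ∃ v x y, IsNormalLabelling Q v x y := by
  obtain ⟨v₀, hv₀⟩ := hQ
  obtain ⟨k, hk⟩ := Finite.exists_max fun i => |cornerArea v₀ i|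
  obtain ⟨v, hv, hmax⟩ : ∃ v, HasVertices Q v ∧ ∀ i, |cornerArea v i| ≤ |cornerArea v 0| := by
    refine ⟨_, hv₀.shift k, fun i => ?_⟩
    rw [cornerArea_shift, cornerArea_shift, zero_add]
    exact hk _
  have n3 : cornerArea v 3 ≠ cornerArea v 0 := fun h => hT ⟨v, hv, by
    rw [cornerArea_three, cornerArea_zero] at h
    simp only [cross, Prod.fst_sub, Prod.snd_sub] at h ⊢
    linarith⟩
  have n1 : cornerArea v 1 ≠ cornerArea v 0 := fun h => hT ⟨_, hv.shift 1, by
    rw [cornerArea_one, cornerArea_zero] at h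
    change cross (v 2 - v 1) (v 3 - v 0) = 0
    simp only [cross, Prod.fst_sub, Prod.snd_sub] at h ⊢
    linarith⟩
  have hs := cornerArea_add v
  have h0 := IsConvexLabelling.ne_zero hv.2 0
  have hpos : ∀ i, 0 < cornerArea v i / cornerArea v 0 := fun i => by
    rcases hv.2 with h | h
    · exact div_pos (h i) (h 0)
    · exact div_pos_of_neg_of_neg (h i) (h 0)
  have hle : ∀ i, cornerArea v i ≠ cornerArea v 0 → cornerArea v i / cornerArea v 0 < 1 := by
    intro i hi
    have h1 : |cornerArea v i / cornerArea v 0| ≤ 1 := by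
      rw [abs_div]
      exact div_le_one_of_le₀ (hmax i) (abs_nonneg _)
    rw [abs_of_pos (hpos i)] at h1
    exact lt_of_le_of_ne h1 fun h => hi ((div_eq_one_iff_eq h0).1 h)
  set x := cornerArea v 3 / cornerArea v 0 with hx
  set y := cornerArea v 1 / cornerArea v 0 with hy
  have hx0 : cornerArea v 3 = x * cornerArea v 0 := by rw [hx]; field_simp
  have hy0 : cornerArea v 1 = y * cornerArea v 0 := by rw [hy]; field_simp
  have hxy : 1 < x + y := by
    have h2 := hpos 2
    have : cornerArea v 2 / cornerArea v 0 = x + y - 1 := by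
      rw [hx, hy]; field_simp; linarith
    linarith
  rcases le_total x y with h | h
  · exact ⟨v, x, y, hv, ⟨h, hle 1 n1, hxy⟩, hx0, hy0⟩
  · refine ⟨_, y, x, hv.reverse 2, ⟨h, hle 3 n3, by linarith⟩, ?_, ?_⟩
    · rw [cornerArea_reverse, cornerArea_reverse]
      change -cornerArea v 1 = y * -cornerArea v 0
      rw [hy0]; ring
    · rw [cornerArea_reverse, cornerArea_reverse]
      change -cornerArea v 3 = x * -cornerArea v 0
      rw [hx0]; ring

/-! ### Necessity of the equations -/

lemma range_fin_four (w : Fin 4 → Plane) : Set.range w = {w 0, w 1, w 2, w 3} := by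
  ext z
  simp [Fin.exists_fin_succ, eq_comm]

lemma range_strip (v : Fin 4 → Plane) (s t s' t' : ℝ) : Set.range (strip v s t s' t') =
    {AffineMap.lineMap (v 0) (v 3) s, AffineMap.lineMap (v 1) (v 2) t,
      AffineMap.lineMap (v 1) (v 2) t', AffineMap.lineMap (v 0) (v 3) s'} :=
  range_fin_four _

lemma lineMap_lineMap_left (a b : Plane) (s u : ℝ) :
    AffineMap.lineMap a (AffineMap.lineMap a b s) u = AffineMap.lineMap a b (u * s) := by
  ext <;> simp [AffineMap.lineMap_apply_module] <;> ring

lemma level_pos {f s : ℝ} (hf : 0 < f) (h0 : 0 ≤ s) (h1 : s ≤ 1) : 0 < (1 - s) * f + s := by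
  simpa using convexCombination_pos hf one_pos h0 h1

/-- All strips of a quadrangle narrow in the same direction as the quadrangle itself. -/
lemma leftRatio_strip_lt_one {v : Fin 4 → Plane} (h : IsConvexLabelling v) {s t s' t' : ℝ}
    (hs : 0 ≤ s) (hss : s < s') (hs' : s' ≤ 1) (ht : t < t') (hl : leftRatio v < 1) :
    leftRatio (strip v s t s' t') < 1 := by
  rw [leftRatio_strip h ht, div_lt_one (level_pos h.leftRatio_pos (by linarith) hs')]
  nlinarith [mul_pos (sub_pos.2 hss) (sub_pos.2 hl)]

lemma one_lt_leftRatio_strip {v : Fin 4 → Plane} (h : IsConvexLabelling v) {s t s' t' : ℝ}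
    (hs : 0 ≤ s) (hss : s < s') (hs' : s' ≤ 1) (ht : t < t') (hl : 1 < leftRatio v) :
    1 < leftRatio (strip v s t s' t') := by
  rw [leftRatio_strip h ht, one_lt_div (level_pos h.leftRatio_pos (by linarith) hs')]
  nlinarith [mul_pos (sub_pos.2 hss) (sub_pos.2 hl)]

lemma image_refl_eq (Q : Set Plane) : (AffineEquiv.refl ℝ Plane) '' Q = Q := by
  simp

lemma mem_familyA_of_typeA {Q : Set Plane} {v : Fin 4 → Plane} {x y : ℝ}
    (h : IsNormalLabelling Q v x y) (hA : HasGlassCutSelfAffinity IsTypeA Q) :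
    (x, y) ∈ familyA := by
  obtain ⟨α, -, -, w, hw, p₁, p₂, q₁, q₂, hp₂, hp₁, hq₂, hq₁, σ, e0, e1, e2⟩ := hA
  rw [openSegment_eq_image_lineMap] at hp₂ hp₁ hq₂ hq₁
  beta_reduce at e0 e1 e2
  obtain ⟨s₂, ⟨hs20, hs21⟩, rfl⟩ := hp₂
  obtain ⟨u, ⟨hu0, hu1⟩, rfl⟩ := hp₁
  obtain ⟨t₂, ⟨ht20, ht21⟩, rfl⟩ := hq₂
  obtain ⟨u', ⟨hu'0, hu'1⟩, rfl⟩ := hq₁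
  rw [lineMap_lineMap_left, lineMap_lineMap_left] at *
  have hs10 : 0 < u * s₂ := mul_pos hu0 hs20
  have hs12 : u * s₂ < s₂ := by nlinarith
  have ht10 : 0 < u' * t₂ := mul_pos hu'0 ht20
  have ht12 : u' * t₂ < t₂ := by nlinarith
  set s₁ := u * s₂
  set t₁ := u' * t₂
  have hwc : IsConvexLabelling w := hw.2
  have E0 : HasVertices (α (σ 0) '' Q) (strip w 0 0 s₁ t₁) :=
    ⟨by rw [e0, range_strip]; simp,
      hwc.strip le_rfl hs10 (by linarith) le_rfl ht10 (by linarith)⟩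
  have E1 : HasVertices (α (σ 1) '' Q) (strip w s₁ t₁ s₂ t₂) :=
    ⟨by rw [e1, range_strip], hwc.strip hs10.le hs12 hs21.le ht10.le ht12 ht21.le⟩
  have E2 : HasVertices (α (σ 2) '' Q) (strip w s₂ t₂ 1 1) :=
    ⟨by rw [e2, range_strip]; simp [Set.insert_comm],
      hwc.strip hs20.le hs21 le_rfl ht20.le ht21 le_rfl⟩
  have E : HasVertices (AffineEquiv.refl ℝ Plane '' Q) w := by rwa [image_refl_eq]
  have hl := level_pos hwc.leftRatio_pos hs10.le (by linarith : s₁ ≤ 1)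
  have hl' := level_pos hwc.leftRatio_pos hs20.le hs21.le
  have hr := level_pos hwc.rightRatio_pos ht10.le (by linarith : t₁ ≤ 1)
  have hr' := level_pos hwc.rightRatio_pos ht20.le ht21.le
  have prod_l : leftRatio w = leftRatio (strip w 0 0 s₁ t₁) * leftRatio (strip w s₁ t₁ s₂ t₂) *
      leftRatio (strip w s₂ t₂ 1 1) := by
    rw [leftRatio_strip hwc ht10, leftRatio_strip hwc ht12, leftRatio_strip hwc ht21,
      div_mul_div_cancel₀ hl.ne', div_mul_div_cancel₀ hl'.ne']
    simp
  have prod_r : rightRatio w = rightRatio (strip w 0 0 s₁ t₁) *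
      rightRatio (strip w s₁ t₁ s₂ t₂) * rightRatio (strip w s₂ t₂ 1 1) := by
    rw [rightRatio_strip hwc hs10, rightRatio_strip hwc hs12, rightRatio_strip hwc hs21,
      div_mul_div_cancel₀ hr.ne', div_mul_div_cancel₀ hr'.ne']
    simp
  rcases (h.leftRatio_ne_one E).lt_or_gt with hlt | hlt
  · exact mem_familyA_of_ratios h.normalized
      (h.ratios_of_image_of_lt_one E hlt)
      (h.ratios_of_image_of_lt_one E0
        (leftRatio_strip_lt_one hwc le_rfl hs10 (by linarith) ht10 hlt))
      (h.ratios_of_image_of_lt_one E1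
        (leftRatio_strip_lt_one hwc hs10.le hs12 hs21.le ht12 hlt))
      (h.ratios_of_image_of_lt_one E2
        (leftRatio_strip_lt_one hwc hs20.le hs21 le_rfl ht21 hlt)) prod_l prod_r
  · exact mem_familyA_of_ratios h.normalized
      (h.ratios_of_image_of_one_lt E hlt)
      (h.ratios_of_image_of_one_lt E0
        (one_lt_leftRatio_strip hwc le_rfl hs10 (by linarith) ht10 hlt))
      (h.ratios_of_image_of_one_lt E1
        (one_lt_leftRatio_strip hwc hs10.le hs12 hs21.le ht12 hlt))
      (h.ratios_of_image_of_one_lt E2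
        (one_lt_leftRatio_strip hwc hs20.le hs21 le_rfl ht21 hlt))
      (by rw [prod_l, mul_inv, mul_inv]) (by rw [prod_r, mul_inv, mul_inv])

lemma ratios_eq_mul_strip {w : Fin 4 → Plane} (hwc : IsConvexLabelling w) {s t : ℝ} (hs0 : 0 < s)
    (hs1 : s < 1) (ht0 : 0 < t) (ht1 : t < 1) :
    leftRatio w = leftRatio (strip w 0 0 s t) * leftRatio (strip w s t 1 1) ∧
      rightRatio w = rightRatio (strip w 0 0 s t) * rightRatio (strip w s t 1 1) := by
  have hl := level_pos hwc.leftRatio_pos hs0.le hs1.le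
  have hr := level_pos hwc.rightRatio_pos ht0.le ht1.le
  constructor
  · rw [leftRatio_strip hwc ht0, leftRatio_strip hwc ht1, div_mul_div_cancel₀ hl.ne']
    simp
  · rw [rightRatio_strip hwc hs0, rightRatio_strip hwc hs1, div_mul_div_cancel₀ hr.ne']
    simp

/-- If a cut splits a quadrangle into two affine copies of `Q`, the ratios of the quadrangle are
products of two ratio pairs. -/
lemma IsNormalLabelling.isPairProduct {Q : Set Plane} {v : Fin 4 → Plane} {x y : ℝ}
    (h : IsNormalLabelling Q v x y) {w : Fin 4 → Plane} (hwc : IsConvexLabelling w) {s t : ℝ}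
    (hs0 : 0 < s) (hs1 : s < 1) (ht0 : 0 < t) (ht1 : t < 1) {α β : Plane ≃ᵃ[ℝ] Plane}
    (hα : HasVertices (α '' Q) (strip w 0 0 s t)) (hβ : HasVertices (β '' Q) (strip w s t 1 1)) :
    IsPairProduct x y (leftRatio w) (rightRatio w) := by
  obtain ⟨el, er⟩ := ratios_eq_mul_strip hwc hs0 hs1 ht0 ht1
  have hne : leftRatio w ≠ 1 := fun hw => by
    apply h.leftRatio_ne_one hβ
    rw [leftRatio_strip hwc ht1, hw]
    simp
  rcases hne.lt_or_gt with hlt | hlt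
  · exact ⟨_, _, _, _,
      h.ratios_of_image_of_lt_one hα (leftRatio_strip_lt_one hwc le_rfl hs0 hs1.le ht0 hlt),
      h.ratios_of_image_of_lt_one hβ (leftRatio_strip_lt_one hwc hs0.le hs1 le_rfl ht1 hlt),
      Or.inl ⟨el, er⟩⟩
  · exact ⟨_, _, _, _,
      h.ratios_of_image_of_one_lt hα (one_lt_leftRatio_strip hwc le_rfl hs0 hs1.le ht0 hlt),
      h.ratios_of_image_of_one_lt hβ (one_lt_leftRatio_strip hwc hs0.le hs1 le_rfl ht1 hlt),
      Or.inr ⟨by rw [el, mul_inv], by rw [er, mul_inv]⟩⟩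

lemma mem_familyB_of_typeB {Q : Set Plane} {v : Fin 4 → Plane} {x y : ℝ}
    (h : IsNormalLabelling Q v x y) (hB : HasGlassCutSelfAffinity IsTypeB Q) :
    (x, y) ∈ familyB₁ ∪ familyB₂ := by
  obtain ⟨α, -, -, w, hw, p, q, m, n, hp, hq, hm, hn, σ, e0, e1, e2⟩ := hB
  rw [openSegment_symm] at hm
  rw [openSegment_eq_image_lineMap] at hp hq hm hn
  beta_reduce at e0 e1 e2
  obtain ⟨s, ⟨hs0, hs1⟩, rfl⟩ := hp
  obtain ⟨t, ⟨ht0, ht1⟩, rfl⟩ := hq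
  obtain ⟨s', ⟨hs'0, hs'1⟩, rfl⟩ := hm
  obtain ⟨t', ⟨ht'0, ht'1⟩, rfl⟩ := hn
  have hwc : IsConvexLabelling w := hw.2
  set R := strip w s t 1 1 with hR
  have hRc : IsConvexLabelling R := hwc.strip hs0.le hs1 le_rfl ht0.le ht1 le_rfl
  have hRc' := hRc.shift 1
  set R' : Fin 4 → Plane := fun i => R (i + 1) with hR'
  have r0 : R' 0 = AffineMap.lineMap (w 1) (w 2) t := rfl
  have r1 : R' 1 = w 2 := by simp [hR', hR, strip]
  have r2 : R' 2 = w 3 := by simp [hR', hR, strip]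
  have r3 : R' 3 = AffineMap.lineMap (w 0) (w 3) s := rfl
  have E : HasVertices (AffineEquiv.refl ℝ Plane '' Q) w := by rwa [image_refl_eq]
  have E0 : HasVertices (α (σ 0) '' Q) (strip w 0 0 s t) :=
    ⟨by rw [e0, range_strip]; simp, hwc.strip le_rfl hs0 hs1.le le_rfl ht0 ht1.le⟩
  have E1 : HasVertices (α (σ 1) '' Q) (strip R' 0 0 s' t') := by
    refine ⟨?_, hRc'.strip le_rfl hs'0 hs'1.le le_rfl ht'0 ht'1.le⟩
    rw [e1, range_strip, r0, r1, r2, r3, AffineMap.lineMap_apply_zero,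
      AffineMap.lineMap_apply_zero]
    congr 1
    ext z
    simp only [Set.mem_insert_iff, Set.mem_singleton_iff]
    tauto
  have E2 : HasVertices (α (σ 2) '' Q) (strip R' s' t' 1 1) := by
    refine ⟨?_, hRc'.strip hs'0.le hs'1 le_rfl ht'0.le ht'1 le_rfl⟩
    rw [e2, range_strip, r0, r1, r2, r3, AffineMap.lineMap_apply_one,
      AffineMap.lineMap_apply_one]
    congr 1
    ext z
    simp only [Set.mem_insert_iff, Set.mem_singleton_iff]
    tauto
  have hg := h.isPairProduct hRc' hs'0 hs'1 ht'0 ht'1 E1 E2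
  obtain ⟨el, er⟩ := ratios_eq_mul_strip hwc hs0 hs1 ht0 ht1
  rcases (h.leftRatio_ne_one E).lt_or_gt with hlt | hlt
  · have hRl : leftRatio R < 1 := leftRatio_strip_lt_one hwc hs0.le hs1 le_rfl ht1 hlt
    obtain ⟨g1, g2⟩ := ratios_shift_one hRc hRl.ne
    rw [g1, g2] at hg
    exact mem_familyB_of_ratios h.normalized (h.ratios_of_image_of_lt_one E hlt)
      (h.ratios_of_image_of_lt_one E0 (leftRatio_strip_lt_one hwc le_rfl hs0 hs1.le ht0 hlt))
      el er hRl (hRc.rightRatio_lt_one hRl) hg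
  · have hRl : 1 < leftRatio R := one_lt_leftRatio_strip hwc hs0.le hs1 le_rfl ht1 hlt
    have hRr := hRc.one_lt_rightRatio hRl
    obtain ⟨g1, g2⟩ := ratios_shift_one hRc hRl.ne'
    rw [g1, g2] at hg
    have l0 := hRc.leftRatio_pos
    have r0 := hRc.rightRatio_pos
    refine mem_familyB_of_ratios h.normalized (h.ratios_of_image_of_one_lt E hlt)
      (h.ratios_of_image_of_one_lt E0 (one_lt_leftRatio_strip hwc le_rfl hs0 hs1.le ht0 hlt))
      (by rw [el, mul_inv]) (by rw [er, mul_inv]) (inv_lt_one_of_one_lt₀ hRl)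
      (inv_lt_one_of_one_lt₀ hRr) ?_
    -- passing to reciprocals exchanges the two ratios with respect to the other pair of sides
    have n1 : 1 - leftRatio R ≠ 0 := by linarith
    have n2 : leftRatio R - 1 ≠ 0 := by linarith
    have k1 : (1 - (rightRatio R)⁻¹) / (1 - (leftRatio R)⁻¹) =
        (1 - rightRatio R) / (1 - leftRatio R) * (leftRatio R / rightRatio R) := by
      have a1 : 1 - (rightRatio R)⁻¹ = -(1 - rightRatio R) / rightRatio R := by
        field_simp
        ring
      have a2 : 1 - (leftRatio R)⁻¹ = -(1 - leftRatio R) / leftRatio R := by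
        field_simp
        ring
      rw [a1, a2]
      field_simp
    have k2 : (1 - (rightRatio R)⁻¹) / (1 - (leftRatio R)⁻¹) *
        ((leftRatio R)⁻¹ / (rightRatio R)⁻¹) = (1 - rightRatio R) / (1 - leftRatio R) := by
      rw [k1]
      field_simp
    rw [k2, k1]
    exact hg.swap

/-! ### Sufficiency of the equations -/

/-- The two ratios determine the quotients of all corner areas, unless they are both one. -/
lemma exists_cornerArea_eq_of_ratios {v w : Fin 4 → Plane} (hv : IsConvexLabelling v)
    (hw : IsConvexLabelling w) (hne : leftRatio v ≠ 1) (hl : leftRatio w = leftRatio v)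
    (hr : rightRatio w = rightRatio v) : ∃ c, ∀ i, cornerArea w i = c * cornerArea v i := by
  have v1 := hv.ne_zero 1
  have v2 := hv.ne_zero 2
  have w1 := hw.ne_zero 1
  have w2 := hw.ne_zero 2
  have av : cornerArea v 0 = leftRatio v * cornerArea v 1 := by unfold leftRatio; field_simp
  have bv : cornerArea v 3 = rightRatio v * cornerArea v 2 := by unfold rightRatio; field_simp
  have aw : cornerArea w 0 = leftRatio v * cornerArea w 1 := by
    rw [← hl]; unfold leftRatio; field_simp
  have bw : cornerArea w 3 = rightRatio v * cornerArea w 2 := by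
    rw [← hr]; unfold rightRatio; field_simp
  have sv := cornerArea_add v
  have sw := cornerArea_add w
  have hrv : 1 - rightRatio v ≠ 0 := by
    obtain ⟨k, hk, e⟩ := hv.exists_one_sub_rightRatio
    rw [e]
    exact mul_ne_zero hk.ne' (sub_ne_zero.2 hne.symm)
  have key : cornerArea w 2 * cornerArea v 1 = cornerArea w 1 * cornerArea v 2 := by
    apply mul_left_cancel₀ hrv
    linear_combination cornerArea v 1 * (bw + sw - aw) - cornerArea w 1 * (bv + sv - av)
  have e1 : cornerArea w 1 = cornerArea w 1 / cornerArea v 1 * cornerArea v 1 := by field_simp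
  have e2 : cornerArea w 2 = cornerArea w 1 / cornerArea v 1 * cornerArea v 2 := by
    field_simp
    exact key
  refine ⟨cornerArea w 1 / cornerArea v 1, fun i => ?_⟩
  fin_cases i
  · change cornerArea w 0 = _ * cornerArea v 0
    linear_combination aw + leftRatio v * e1 - cornerArea w 1 / cornerArea v 1 * av
  · exact e1
  · exact e2
  · change cornerArea w 3 = _ * cornerArea v 3
    linear_combination bw + rightRatio v * e2 - cornerArea w 1 / cornerArea v 1 * bv

lemma exists_image_eq_of_ratios {Q : Set Plane} {v w : Fin 4 → Plane} (hv : HasVertices Q v)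
    (hw : IsConvexLabelling w) (hne : leftRatio v ≠ 1) (hl : leftRatio w = leftRatio v)
    (hr : rightRatio w = rightRatio v) :
    ∃ α : Plane ≃ᵃ[ℝ] Plane, α '' Q = convexHull ℝ (Set.range w) := by
  have hvc : IsConvexLabelling v := hv.2
  obtain ⟨c, hc⟩ := exists_cornerArea_eq_of_ratios hvc hw hne hl hr
  obtain ⟨α, hα⟩ := exists_affineEquiv (hvc.ne_zero 0) (hw.ne_zero 0) hc
  refine ⟨α, ?_⟩
  rw [(hv.map α).1, funext hα]

lemma ratios_reverse (w : Fin 4 → Plane) :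
    leftRatio (fun i => w (3 - i)) = (leftRatio w)⁻¹ ∧
      rightRatio (fun i => w (3 - i)) = (rightRatio w)⁻¹ := by
  unfold leftRatio rightRatio
  simp only [cornerArea_reverse, neg_div_neg_eq, inv_div]
  exact ⟨rfl, rfl⟩

namespace IsNormalLabelling

variable {Q : Set Plane} {v : Fin 4 → Plane} {x y : ℝ}

lemma ratios_shift (h : IsNormalLabelling Q v x y) (k : Fin 4) :
    leftRatio (fun i => v (i + k)) =
        ![1, y, x + y - 1, x] (0 + k) / ![1, y, x + y - 1, x] (1 + k) ∧
      rightRatio (fun i => v (i + k)) =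
        ![1, y, x + y - 1, x] (3 + k) / ![1, y, x + y - 1, x] (2 + k) := by
  have h0 := h.convexLabelling.ne_zero 0
  unfold leftRatio rightRatio
  simp only [cornerArea_shift, h.cornerArea_eq (_ + k), mul_div_mul_left _ _ h0, and_self]

lemma ratios_reverse (h : IsNormalLabelling Q v x y) (k : Fin 4) :
    leftRatio (fun i => v (k - i)) =
        ![1, y, x + y - 1, x] (k - 0 - 2) / ![1, y, x + y - 1, x] (k - 1 - 2) ∧
      rightRatio (fun i => v (k - i)) =
        ![1, y, x + y - 1, x] (k - 3 - 2) / ![1, y, x + y - 1, x] (k - 2 - 2) := by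
  have h0 := h.convexLabelling.ne_zero 0
  unfold leftRatio rightRatio
  simp only [cornerArea_reverse, neg_div_neg_eq, h.cornerArea_eq (_ - 2),
    mul_div_mul_left _ _ h0, and_self]

/-- Every ratio pair belongs to some labelling of `Q` itself. -/
lemma exists_image_eq (h : IsNormalLabelling Q v x y) {w : Fin 4 → Plane}
    (hw : IsConvexLabelling w) (hr : IsRatioPair x y (leftRatio w) (rightRatio w)) :
    ∃ α : Plane ≃ᵃ[ℝ] Plane, α '' Q = convexHull ℝ (Set.range w) := by
  have hlt := hr.left_lt_one h.normalized
  have key : ∀ u : Fin 4 → Plane, HasVertices Q u → leftRatio w = leftRatio u →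
      rightRatio w = rightRatio u →
      ∃ α : Plane ≃ᵃ[ℝ] Plane, α '' Q = convexHull ℝ (Set.range w) := fun u hu e1 e2 =>
    exists_image_eq_of_ratios hu hw (e1 ▸ hlt.ne) e1 e2
  rcases hr with ⟨e1, e2⟩ | ⟨e1, e2⟩ | ⟨e1, e2⟩ | ⟨e1, e2⟩
  · obtain ⟨k1, k2⟩ := h.ratios_reverse 0
    refine key _ (h.hasVertices.reverse 0) (e1.trans ?_) (e2.trans ?_)
    · rw [k1]; rfl
    · rw [k2]; exact (div_one x).symm
  · obtain ⟨k1, k2⟩ := h.ratios_shift 3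
    refine key _ (h.hasVertices.shift 3) (e1.trans ?_) (e2.trans ?_)
    · rw [k1]; exact (div_one x).symm
    · rw [k2]; rfl
  · obtain ⟨k1, k2⟩ := h.ratios_shift 2
    refine key _ (h.hasVertices.shift 2) (e1.trans ?_) (e2.trans ?_)
    · rw [k1]; rfl
    · rw [k2]; exact (div_one y).symm
  · obtain ⟨k1, k2⟩ := h.ratios_reverse 3
    refine key _ (h.hasVertices.reverse 3) (e1.trans ?_) (e2.trans ?_)
    · rw [k1]; exact (div_one y).symm
    · rw [k2]; rfl

lemma exists_image_eq_of_inv (h : IsNormalLabelling Q v x y) {w : Fin 4 → Plane}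
    (hw : IsConvexLabelling w) (hr : IsRatioPair x y (leftRatio w)⁻¹ (rightRatio w)⁻¹) :
    ∃ α : Plane ≃ᵃ[ℝ] Plane, α '' Q = convexHull ℝ (Set.range w) := by
  obtain ⟨e1, e2⟩ := QuadDissection.ratios_reverse w
  rw [← e1, ← e2] at hr
  have hw' : IsConvexLabelling fun i => w (3 - i) :=
    (HasVertices.reverse (Q := convexHull ℝ (Set.range w)) ⟨rfl, hw⟩ 3).2
  have := h.exists_image_eq hw' hr
  rwa [range_reverse] at this

end IsNormalLabelling

/-- The factorization `f = a * a'` is realized by a parameter `s` for which `(1 - s) * f + s`, the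
relative distance of a point of the side, equals `a'`. -/
lemma exists_level {f a a' : ℝ} (hf : f = a * a') (h : 0 < a ∧ a < 1 ∧ 0 < a' ∧ a' < 1 ∨
    1 < a ∧ 1 < a') : ∃ s, 0 < s ∧ s < 1 ∧ (1 - s) * f + s = a' := by
  rcases h with ⟨h1, h2, h3, h4⟩ | ⟨h1, h2⟩
  · have l1 : f < a' := by rw [hf]; nlinarith
    have l2 : 0 < 1 - f := by linarith
    refine ⟨(a' - f) / (1 - f), div_pos (by linarith) l2, (div_lt_one l2).2 (by linarith), ?_⟩
    field_simp
    ring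
  · have l1 : a' < f := by rw [hf]; nlinarith
    have l2 : 0 < f - 1 := by linarith
    refine ⟨(f - a') / (f - 1), div_pos (by linarith) l2, (div_lt_one l2).2 (by linarith), ?_⟩
    field_simp
    ring

/-- A factorization of the ratios of a quadrangle is realized by a cut between the two sides. -/
lemma exists_strip_ratios {w : Fin 4 → Plane} (hw : IsConvexLabelling w) {a b a' b' : ℝ}
    (hl : leftRatio w = a * a') (hr : rightRatio w = b * b')
    (ha : 0 < a ∧ a < 1 ∧ 0 < a' ∧ a' < 1 ∨ 1 < a ∧ 1 < a')
    (hb : 0 < b ∧ b < 1 ∧ 0 < b' ∧ b' < 1 ∨ 1 < b ∧ 1 < b') :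
    ∃ s t : ℝ, 0 < s ∧ s < 1 ∧ 0 < t ∧ t < 1 ∧
      leftRatio (strip w 0 0 s t) = a ∧ rightRatio (strip w 0 0 s t) = b ∧
      leftRatio (strip w s t 1 1) = a' ∧ rightRatio (strip w s t 1 1) = b' := by
  obtain ⟨s, hs0, hs1, hs⟩ := exists_level hl ha
  obtain ⟨t, ht0, ht1, ht⟩ := exists_level hr hb
  have ha' : a' ≠ 0 := by
    rcases ha with h | h
    · exact h.2.2.1.ne'
    · linarith
  have hb' : b' ≠ 0 := by
    rcases hb with h | h
    · exact h.2.2.1.ne'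
    · linarith
  refine ⟨s, t, hs0, hs1, ht0, ht1, ?_, ?_, ?_, ?_⟩
  · rw [leftRatio_strip hw ht0, hs, hl]; field_simp; ring
  · rw [rightRatio_strip hw hs0, ht, hr]; field_simp; ring
  · rw [leftRatio_strip hw ht1, hs]; simp
  · rw [rightRatio_strip hw hs1, ht]; simp

lemma IsOfAffineType.exists_isNormalLabelling {Q : Set Plane} {x y : ℝ}
    (h : IsOfAffineType Q x y) (hn : IsNormalized x y) : ∃ v, IsNormalLabelling Q v x y := by
  obtain ⟨v, hv, φ, e0, e1, e2, e3⟩ := h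
  obtain ⟨D, hD, hA⟩ := exists_cornerArea_map φ
  have a0 := hA v 0
  have a1 := hA v 1
  have a3 := hA v 3
  rw [cornerArea_zero, e0, e1, e2] at a0
  rw [cornerArea_one, e1, e2, e3] at a1
  rw [cornerArea_three, e0, e1, e3] at a3
  simp [cross] at a0 a1 a3
  refine ⟨v, hv, hn, ?_, ?_⟩
  · apply mul_left_cancel₀ hD
    linear_combination x * a0 - a3
  · apply mul_left_cancel₀ hD
    linear_combination y * a0 - a1

/-- With `R = (x + y - 1) / x`, the equation of the family says that the ratios `x` and
`(x + y - 1) / y` of `Q` are `y * y * R` and `R * R * y`, so two cuts produce three pieces with the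
ratio pair `(y, R)` or `(R, y)`. -/
lemma typeA_of_mem_familyA {Q : Set Plane} {v : Fin 4 → Plane} {x y : ℝ}
    (h : IsNormalLabelling Q v x y) (hxy : (x, y) ∈ familyA) :
    HasGlassCutSelfAffinity IsTypeA Q := by
  obtain ⟨-, -, -, heq⟩ := hxy
  have hn := h.normalized
  have hx := hn.x_pos
  have hy := hn.y_pos
  have hy1 := hn.lt_one
  have hz := hn.z_pos
  have hR1 : (x + y - 1) / x < 1 := hn.z_div_x_lt.trans hy1
  have hR0 : 0 < (x + y - 1) / x := by positivity
  obtain ⟨el, er⟩ := h.ratios_shift 3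
  have hw := h.hasVertices.shift 3
  set w : Fin 4 → Plane := fun i => v (i + 3)
  have hwc : IsConvexLabelling w := hw.2
  have wl : leftRatio w = y * y * ((x + y - 1) / x) := by
    rw [el]
    change x / 1 = _
    field_simp
    linear_combination -heq
  have wr : rightRatio w = (x + y - 1) / x * ((x + y - 1) / x) * y := by
    rw [er]
    change (x + y - 1) / y = _
    field_simp
    linear_combination -heq
  obtain ⟨s, t, hs0, hs1, ht0, ht1, l1, r1, l2, r2⟩ := exists_strip_ratios hwc wl wr
    (Or.inl ⟨by positivity, by nlinarith, hR0, hR1⟩)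
    (Or.inl ⟨by positivity, by nlinarith, hy, hy1⟩)
  have hRc := hwc.strip le_rfl hs0 hs1.le le_rfl ht0 ht1.le
  have hcut := isGlassCut_strip hwc hs0 hs1 ht0 ht1
  have hlast := hwc.strip hs0.le hs1 le_rfl ht0.le ht1 le_rfl
  set R := strip w 0 0 s t with hRdef
  obtain ⟨s', t', hs'0, hs'1, ht'0, ht'1, l1', r1', l2', r2'⟩ := exists_strip_ratios hRc l1 r1
    (Or.inl ⟨hy, hy1, hy, hy1⟩) (Or.inl ⟨hR0, hR1, hR0, hR1⟩)
  have hcut' := isGlassCut_strip hRc hs'0 hs'1 ht'0 ht'1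
  obtain ⟨α₀, h₀⟩ := h.exists_image_eq (hRc.strip le_rfl hs'0 hs'1.le le_rfl ht'0 ht'1.le)
    (Or.inr (Or.inr (Or.inr ⟨l1', r1'⟩)))
  obtain ⟨α₁, h₁⟩ := h.exists_image_eq (hRc.strip hs'0.le hs'1 le_rfl ht'0.le ht'1 le_rfl)
    (Or.inr (Or.inr (Or.inr ⟨l2', r2'⟩)))
  obtain ⟨α₂, h₂⟩ := h.exists_image_eq hlast (Or.inr (Or.inr (Or.inl ⟨l2, r2⟩)))
  have hD : (fun i => (![α₂, α₀, α₁] i : Plane ≃ᵃ[ℝ] Plane) '' Q) =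
      ![α₂ '' Q, α₀ '' Q, α₁ '' Q] := by
    funext i; fin_cases i <;> rfl
  rw [← h₂, ← hw.1] at hcut
  rw [← h₀, ← h₁] at hcut'
  have r0 : R 0 = w 0 := by simp [hRdef, strip]
  have r1 : R 1 = w 1 := by simp [hRdef, strip]
  have r2 : R 2 = AffineMap.lineMap (w 1) (w 2) t := rfl
  have r3 : R 3 = AffineMap.lineMap (w 0) (w 3) s := rfl
  refine ⟨![α₂, α₀, α₁], ?_, ?_, ?_⟩
  · rw [hD]; exact isDissection_of_two_cuts hcut.symm hcut'
  · rw [hD]; exact isGlassCutDissection_of_two_cuts hcut.symm hcut'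
  · rw [hD]
    refine ⟨w, hw, AffineMap.lineMap (R 0) (R 3) s', R 3, AffineMap.lineMap (R 1) (R 2) t', R 2,
      ?_, ?_, ?_, ?_, finRotate 3, ?_, ?_, ?_⟩
    · rw [r3, openSegment_eq_image_lineMap]; exact ⟨s, ⟨hs0, hs1⟩, rfl⟩
    · rw [r0, openSegment_eq_image_lineMap]; exact ⟨s', ⟨hs'0, hs'1⟩, rfl⟩
    · rw [r2, openSegment_eq_image_lineMap]; exact ⟨t, ⟨ht0, ht1⟩, rfl⟩
    · rw [r1, openSegment_eq_image_lineMap]; exact ⟨t', ⟨ht'0, ht'1⟩, rfl⟩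
    · change α₀ '' Q = _
      rw [h₀, range_strip, r0, r1]
      simp
    · change α₁ '' Q = _
      rw [h₁, range_strip]
      simp only [AffineMap.lineMap_apply_one]
    · change α₂ '' Q = _
      rw [h₂, range_strip, r2, r3]
      congr 1
      simp only [AffineMap.lineMap_apply_one]

/-- The construction for both families of type B. The second cut splits the ratios at the other
apex, which are `x ^ 2` or `x * y` and its companion, into two ratio pairs. -/
lemma typeB_of_pairs {Q : Set Plane} {v : Fin 4 → Plane} {x y : ℝ}
    (h : IsNormalLabelling Q v x y) (hxy : x < y) {ρ σ : ℝ} (hρ : IsRatioPair x y ρ σ)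
    (hρσ : ρ * (x + y - 1) = σ * x * y)
    (heq : y ^ 2 * (x + y - 1 - x ^ 2) = x * ρ * (x + y - 1) * (y ^ 2 - (x + y - 1))) :
    HasGlassCutSelfAffinity IsTypeB Q := by
  have hn := h.normalized
  have hx := hn.x_pos
  have hy := hn.y_pos
  have hy1 := hn.lt_one
  have hx1 := hn.x_lt_one
  have hz := hn.z_pos
  have hρ0 := hρ.left_pos hn
  have hρ1 := hρ.left_lt_one hn
  have hσ0 := hρ.swap.left_pos hn
  have hσ1 := hρ.swap.left_lt_one hn
  have hr1 : (x + y - 1) / y < 1 := hn.z_div_y_lt.trans hx1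
  have hr0 : 0 < (x + y - 1) / y := by positivity
  -- both factors have the same sign by the equation, and their sum `y ^ 2 - x ^ 2` is positive
  have hp : 0 < y ^ 2 - (x + y - 1) := by
    by_contra hcon
    have h1 : x * ρ * (x + y - 1) * (y ^ 2 - (x + y - 1)) ≤ 0 :=
      mul_nonpos_of_nonneg_of_nonpos (by positivity) (not_lt.1 hcon)
    have h2 : 0 < x + y - 1 - x ^ 2 := by nlinarith
    have : 0 < y ^ 2 * (x + y - 1 - x ^ 2) := by positivity
    linarith
  have hq : 0 < x + y - 1 - x ^ 2 := by
    have : 0 < y ^ 2 * (x + y - 1 - x ^ 2) := by rw [heq]; positivity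
    exact pos_of_mul_pos_right this (by positivity)
  obtain ⟨el, er⟩ := h.ratios_shift 3
  have hw := h.hasVertices.shift 3
  set w : Fin 4 → Plane := fun i => v (i + 3)
  have hwc : IsConvexLabelling w := hw.2
  have wl : leftRatio w = (x + y - 1) / x * (x ^ 2 / (x + y - 1)) := by
    rw [el]
    change x / 1 = _
    field_simp
  have wr : rightRatio w = y * ((x + y - 1) / y ^ 2) := by
    rw [er]
    change (x + y - 1) / y = _
    field_simp
  have hc1 : x ^ 2 / (x + y - 1) < 1 := by rw [div_lt_one hz]; linarith
  have hd1 : (x + y - 1) / y ^ 2 < 1 := by rw [div_lt_one (by positivity)]; linarith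
  obtain ⟨s, t, hs0, hs1, ht0, ht1, l1, r1, l2, r2⟩ := exists_strip_ratios hwc wl wr
    (Or.inl ⟨by positivity, hn.z_div_x_lt.trans hy1, by positivity, hc1⟩)
    (Or.inl ⟨hy, hy1, by positivity, hd1⟩)
  have hfirst := hwc.strip le_rfl hs0 hs1.le le_rfl ht0 ht1.le
  have hcut := isGlassCut_strip hwc hs0 hs1 ht0 ht1
  have hRc := hwc.strip hs0.le hs1 le_rfl ht0.le ht1 le_rfl
  set R := strip w s t 1 1 with hRdef
  have hRc' := hRc.shift 1
  obtain ⟨g1, g2⟩ := ratios_shift_one hRc (by rw [l2]; exact hc1.ne)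
  set R' : Fin 4 → Plane := fun i => R (i + 1) with hR'
  have key : (1 - rightRatio R) / (1 - leftRatio R) = x⁻¹ * ρ⁻¹ := by
    rw [l2, r2, div_eq_iff (by linarith)]
    field_simp
    linear_combination -heq
  rw [key] at g1 g2
  have g2' : rightRatio R' = ((x + y - 1) / y)⁻¹ * σ⁻¹ := by
    rw [g2, l2, r2]
    field_simp
    linear_combination -hρσ
  obtain ⟨s', t', hs'0, hs'1, ht'0, ht'1, l1', r1', l2', r2'⟩ := exists_strip_ratios hRc' g1 g2'
    (Or.inr ⟨(one_lt_inv₀ hx).2 hx1, (one_lt_inv₀ hρ0).2 hρ1⟩)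
    (Or.inr ⟨(one_lt_inv₀ hr0).2 hr1, (one_lt_inv₀ hσ0).2 hσ1⟩)
  have hcut' := isGlassCut_strip hRc' hs'0 hs'1 ht'0 ht'1
  obtain ⟨α₀, h₀⟩ := h.exists_image_eq hfirst (Or.inr (Or.inr (Or.inl ⟨l1, r1⟩)))
  obtain ⟨α₁, h₁⟩ := h.exists_image_eq_of_inv
    (hRc'.strip le_rfl hs'0 hs'1.le le_rfl ht'0 ht'1.le)
    (by rw [l1', r1', inv_inv, inv_inv]; exact Or.inr (Or.inl ⟨rfl, rfl⟩))
  obtain ⟨α₂, h₂⟩ := h.exists_image_eq_of_inv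
    (hRc'.strip hs'0.le hs'1 le_rfl ht'0.le ht'1 le_rfl)
    (by rw [l2', r2', inv_inv, inv_inv]; exact hρ)
  have hD : (fun i => (![α₀, α₁, α₂] i : Plane ≃ᵃ[ℝ] Plane) '' Q) =
      ![α₀ '' Q, α₁ '' Q, α₂ '' Q] := by
    funext i; fin_cases i <;> rfl
  rw [← h₀, ← hw.1] at hcut
  rw [← h₁, ← h₂, range_shift] at hcut'
  have r0 : R' 0 = AffineMap.lineMap (w 1) (w 2) t := rfl
  have r1 : R' 1 = w 2 := by simp [hR', hRdef, strip]
  have r2 : R' 2 = w 3 := by simp [hR', hRdef, strip]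
  have r3 : R' 3 = AffineMap.lineMap (w 0) (w 3) s := rfl
  refine ⟨![α₀, α₁, α₂], ?_, ?_, ?_⟩
  · rw [hD]; exact isDissection_of_two_cuts hcut hcut'
  · rw [hD]; exact isGlassCutDissection_of_two_cuts hcut hcut'
  · rw [hD]
    refine ⟨w, hw, R' 3, R' 0, AffineMap.lineMap (R' 0) (R' 3) s',
      AffineMap.lineMap (R' 1) (R' 2) t', ?_, ?_, ?_, ?_, 1, ?_, ?_, ?_⟩
    · rw [r3, openSegment_eq_image_lineMap]; exact ⟨s, ⟨hs0, hs1⟩, rfl⟩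
    · rw [r0, openSegment_eq_image_lineMap]; exact ⟨t, ⟨ht0, ht1⟩, rfl⟩
    · rw [openSegment_symm, openSegment_eq_image_lineMap]; exact ⟨s', ⟨hs'0, hs'1⟩, rfl⟩
    · rw [r1, r2, openSegment_eq_image_lineMap]; exact ⟨t', ⟨ht'0, ht'1⟩, rfl⟩
    · change α₀ '' Q = _
      rw [h₀, range_strip, r0, r3, AffineMap.lineMap_apply_zero, AffineMap.lineMap_apply_zero]
    · change α₁ '' Q = _
      rw [h₁, range_strip, r1, AffineMap.lineMap_apply_zero, AffineMap.lineMap_apply_zero]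
      congr 1
      ext z
      simp only [Set.mem_insert_iff, Set.mem_singleton_iff]
      tauto
    · change α₂ '' Q = _
      rw [h₂, range_strip, ← r2, AffineMap.lineMap_apply_one, AffineMap.lineMap_apply_one]
      congr 1
      ext z
      simp only [Set.mem_insert_iff, Set.mem_singleton_iff]
      tauto

lemma typeB_of_mem_familyB {Q : Set Plane} {v : Fin 4 → Plane} {x y : ℝ}
    (h : IsNormalLabelling Q v x y) (hxy : (x, y) ∈ familyB₁ ∪ familyB₂) :
    HasGlassCutSelfAffinity IsTypeB Q := by
  have hx := h.normalized.x_pos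
  have hy := h.normalized.y_pos
  rcases hxy with ⟨-, -, hlt, heq⟩ | ⟨-, -, hlt, heq⟩
  · refine typeB_of_pairs h hlt (ρ := x) (σ := (x + y - 1) / y) (Or.inr (Or.inl ⟨rfl, rfl⟩)) ?_ ?_
    · field_simp
    · linear_combination (1 - x) * (x + y) * heq
  · refine typeB_of_pairs h hlt (ρ := y) (σ := (x + y - 1) / x)
      (Or.inr (Or.inr (Or.inr ⟨rfl, rfl⟩))) ?_ ?_
    · field_simp
    · linear_combination y * heq

end QuadDissection

theorem mainTheorem3 (Q : Set Plane) (hQ : QuadDissection.IsConvexQuadrangle Q)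
    (hT : ¬ QuadDissection.IsTrapezoid Q) :
    (QuadDissection.HasGlassCutSelfAffinity QuadDissection.IsTypeA Q ↔
      ∃ x y : ℝ, (x, y) ∈ QuadDissection.familyA ∧ QuadDissection.IsOfAffineType Q x y) ∧
    (QuadDissection.HasGlassCutSelfAffinity QuadDissection.IsTypeB Q ↔
      ∃ x y : ℝ, (x, y) ∈ QuadDissection.familyB₁ ∪ QuadDissection.familyB₂ ∧
        QuadDissection.IsOfAffineType Q x y) := by
  obtain ⟨v, x, y, h⟩ := QuadDissection.exists_isNormalLabelling hQ hT
  refine ⟨⟨fun hA => ⟨x, y, QuadDissection.mem_familyA_of_typeA h hA, h.isOfAffineType⟩, ?_⟩,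
    ⟨fun hB => ⟨x, y, QuadDissection.mem_familyB_of_typeB h hB, h.isOfAffineType⟩, ?_⟩⟩
  · rintro ⟨x', y', hxy, hty⟩
    have hn : QuadDissection.IsNormalized x' y' := ⟨hxy.2.2.1.le, hxy.2.1, hxy.1⟩
    obtain ⟨v', h'⟩ := hty.exists_isNormalLabelling hn
    exact QuadDissection.typeA_of_mem_familyA h' hxy
  · rintro ⟨x', y', hxy, hty⟩
    have hn : QuadDissection.IsNormalized x' y' := by
      rcases hxy with hxy | hxy <;> exact ⟨hxy.2.2.1.le, hxy.2.1, hxy.1⟩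
    obtain ⟨v', h'⟩ := hty.exists_isNormalLabelling hn
    exact QuadDissection.typeB_of_mem_familyB h' hxy
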